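/- Let $H$ be a locally compact (Hausdorff) group acting on a nonempty set $V$ with open point stabilizers. Let $\mu:V\times V\to\{1,2,3,\dots,\infty\}$ be an $H$-invariant Coxeter matrix: $\mu$ is symmetric, $\mu(v,v)=1$, $\mu(v,w)\ge 2$ for $v\ne w$, and $\mu(gv,gw)=\mu(v,w)$ for all $g\in H$ and $v,w\in V$. Let $$W(V,\mu)=\big\langle (w_v)_{v\in V}\ \big|\ (w_sw_t)^{\mu(s,t)}=1\text{ for all } s,t\in V \text{ with }\mu(s,t)<\infty\big\rangle$$ be the corresponding Coxeter group, on which $H$ acts by $g\cdot w_s=w_{gs}$, and let $G=W(V,\mu)\rtimes H$ be the wreathed Coxeter group, with the product topology for which $W(V,\mu)$ is discrete. Let $P=\{(v,w)\in V^2:\mu(v,w)<\infty\}$, on which $H$ acts diagonally. A topological group is compactly generated if it is generated by a compact subset; it is compactly presented if it has a presentation $\langle S\mid R\rangle$ with $S$ a compact subset of the group and $R$ a set of words in $S^{\pm1}$ of bounded length. A compactly generated locally compact group $G$ is INIP (infinitely independently presented) if there are a compactly presented locally compact group $G_0$ and an open continuous surjective homomorphism $G_0\to G$ with discrete kernel such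 that the kernel is generated by a family $(N_i)_{i\in I}$ of normal subgroups of $G_0$, with $I$ infinite, which is independent: no $N_i$ is contained in the subgroup generated by the $N_j$, $j\ne i$. Then: 1. $G$ is compactly presented if and only if the following three conditions hold: $V$ has finitely many $H$-orbits and all its point stabilizers are compactly generated; $H$ is compactly presented; $P$ consists of finitely many $H$-orbits. 2. In particular, if $V=H/L$ as an $H$-set, for a subgroup $L$ of $H$, and $\mu$ has no entry $\infty$, then $P$ consists of finitely many $H$-orbits if and only if the double coset space $L\backslash H/L$ is finite; thus $G$ is compactly presented if and only if $H$ is compactly presented, $L$ is compactly generated and $L\backslash H/L$ is finite. 3. If $G$ is compactly generated and $P$ consists of infinitely many $H$-orbits, then $G$ is INIP. -/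

import Mathlib

universe u v w

/-- A topological group is compactly generated if some compact subset generates it as an
abstract group. -/
def IsCompactlyGeneratedGroup (G : Type w) [Group G] [TopologicalSpace G] : Prop :=
  ∃ S : Set G, IsCompact S ∧ Subgroup.closure S = ⊤

/-- A topological group is compactly presented if, as an abstract group, it has a presentation
`⟨S | R⟩` with `S` a compact subset of the group and `R` a set of relators given by words of
bounded length. -/
def IsCompactlyPresentedGroup (G : Type w) [Group G] [TopologicalSpace G] : Prop :=
  ∃ S : Set G, IsCompact S ∧ Subgroup.closure S = ⊤ ∧
    ∃ (R : Set (FreeGroup S)) (n : ℕ),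
      (∀ r ∈ R, ∃ l : List (S × Bool), l.length ≤ n ∧ FreeGroup.mk l = r) ∧
      Subgroup.normalClosure R = (FreeGroup.lift (Subtype.val : S → G)).ker

/-- A family of subgroups is independent if no member is contained in the subgroup generated by
the others. -/
def IndependentSubgroups {G : Type w} [Group G] {ι : Type w} (N : ι → Subgroup G) : Prop :=
  ∀ i, ¬ N i ≤ ⨆ j : {j : ι // j ≠ i}, N j

/-- A compactly generated group is INIP (infinitely independently presented) if it is the
quotient of a compactly presented locally compact (Hausdorff) group `G₀` by a discrete normal
subgroup that is generated by an infinite independent family of normal subgroups of `G₀`.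
Every subgroup of the discrete kernel is closed in `G₀`, so no closures are needed; as `π` is an
open quotient map, `G` is then automatically a locally compact group. -/
def IsINIP (G : Type w) [Group G] [TopologicalSpace G] : Prop :=
  IsCompactlyGeneratedGroup G ∧
  ∃ (G₀ : Type w) (_ : Group G₀) (_ : TopologicalSpace G₀) (_ : IsTopologicalGroup G₀)
    (_ : LocallyCompactSpace G₀) (_ : T2Space G₀) (π : G₀ →* G),
    IsCompactlyPresentedGroup G₀ ∧ IsOpenQuotientMap π ∧ DiscreteTopology π.ker ∧
    ∃ (ι : Type w) (N : ι → Subgroup G₀), Infinite ι ∧ (∀ i, (N i).Normal) ∧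
      IndependentSubgroups N ∧ ⨆ i, N i = π.ker

section Wreathed

variable {V : Type u} {H : Type v} [Group H] [MulAction H V]

/-- The endomorphism `w_s ↦ w_{g s}` of the Coxeter group. (In a `CoxeterMatrix` the entry `0`
stands for `∞`.) -/
def coxeterActionHom (μ : CoxeterMatrix V)
    (hμ : ∀ (g : H) (s t : V), μ (g • s) (g • t) = μ s t) (g : H) : μ.Group →* μ.Group :=
  PresentedGroup.toGroup (f := fun s : V => μ.simple (g • s)) (by
    rintro _ ⟨⟨s, t⟩, rfl⟩
    have h := μ.toCoxeterSystem.simple_mul_simple_pow (g • s) (g • t)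
    rw [hμ] at h
    simpa [Function.uncurry, CoxeterMatrix.relation] using h)

theorem coxeterActionHom_simple (μ : CoxeterMatrix V)
    (hμ : ∀ (g : H) (s t : V), μ (g • s) (g • t) = μ s t) (g : H) (s : V) :
    coxeterActionHom μ hμ g (μ.simple s) = μ.simple (g • s) :=
  PresentedGroup.toGroup.of _

theorem coxeterActionHom_mul (μ : CoxeterMatrix V)
    (hμ : ∀ (g : H) (s t : V), μ (g • s) (g • t) = μ s t) (g h : H) :
    (coxeterActionHom μ hμ g).comp (coxeterActionHom μ hμ h) = coxeterActionHom μ hμ (g * h) := by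
  refine PresentedGroup.ext fun s => ?_
  change coxeterActionHom μ hμ g (coxeterActionHom μ hμ h (μ.simple s)) =
    coxeterActionHom μ hμ (g * h) (μ.simple s)
  simp only [coxeterActionHom_simple, mul_smul]

theorem coxeterActionHom_one (μ : CoxeterMatrix V)
    (hμ : ∀ (g : H) (s t : V), μ (g • s) (g • t) = μ s t) :
    coxeterActionHom μ hμ 1 = MonoidHom.id _ := by
  refine PresentedGroup.ext fun s => ?_
  change coxeterActionHom μ hμ 1 (μ.simple s) = μ.simple s
  simp only [coxeterActionHom_simple, one_smul]

/-- The action of `H` on the Coxeter group `W(V, μ)` by automorphisms, `g · w_s = w_{g s}`. -/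
def coxeterAction (μ : CoxeterMatrix V)
    (hμ : ∀ (g : H) (s t : V), μ (g • s) (g • t) = μ s t) : H →* MulAut μ.Group where
  toFun g := MonoidHom.toMulEquiv (coxeterActionHom μ hμ g) (coxeterActionHom μ hμ g⁻¹)
    (by rw [coxeterActionHom_mul, inv_mul_cancel, coxeterActionHom_one])
    (by rw [coxeterActionHom_mul, mul_inv_cancel, coxeterActionHom_one])
  map_one' := MulEquiv.ext fun x => DFunLike.congr_fun (coxeterActionHom_one μ hμ) x
  map_mul' g h := MulEquiv.ext fun x =>
    (DFunLike.congr_fun (coxeterActionHom_mul μ hμ g h) x).symm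

/-- The wreathed Coxeter group `W(V, μ) ⋊ H`. -/
abbrev WreathedCoxeterGroup (μ : CoxeterMatrix V)
    (hμ : ∀ (g : H) (s t : V), μ (g • s) (g • t) = μ s t) : Type (max u v) :=
  SemidirectProduct μ.Group H (coxeterAction μ hμ)

/-- The product topology on `W(V, μ) ⋊ H`, where `W(V, μ)` is discrete. -/
instance wreathedCoxeterTopology [TopologicalSpace H] (μ : CoxeterMatrix V)
    (hμ : ∀ (g : H) (s t : V), μ (g • s) (g • t) = μ s t) :
    TopologicalSpace (WreathedCoxeterGroup μ hμ) :=
  letI : TopologicalSpace μ.Group := ⊥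
  TopologicalSpace.induced (fun x => (x.left, x.right)) inferInstance

end Wreathed

-- Compact presentability is tested by a universal property, `PresentedByWords`: for some compact
-- generating set `S` and some `n`, every map to a group that is multiplicative on words of length
-- at most `n` in `S` agrees on `S` with a homomorphism. This replaces computations with relators.
--
-- Sufficiency. `W ⋊ H` is generated by `H` and one `w_r` for each orbit representative `r`. Its
-- relations are those of `H`, the commutation of `w_r` with the stabilizer of `r`, and one Coxeter
-- relation for each orbit on `P`. Under the three conditions all of them follow from words of
-- bounded length in a compact set (`wreathed_isCompactlyPresentedGroup`).
--
-- Necessity. `H` is a retract of `W ⋊ H`, hence inherits compact presentability. The rest comes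
-- from one fact, `exists_finset_ker_le`: if a compactly generated group maps onto a compactly
-- presented one by an open quotient map with discrete kernel, and normal subgroups generate the
-- kernel, then finitely many of them already contain it. It is applied to wreathed Coxeter groups
-- with fewer relations. For a stabilizer `L`, the orbit `H/L` is replaced by `H/M` with `M ≤ L`
-- open and compactly generated; finitely many relations `w_M = w_{lM}` must suffice, and the
-- corresponding `l` generate `L` together with `M`. For `P`, all off-diagonal entries are replaced
-- by `∞`; the relations of the various classes of pairs are independent, so there are finitely many
-- classes.
--
-- That nothing more collapses is read off the geometric representation: distinct generators differ,
-- `w_s w_t` has infinite order when `μ s t = ∞`, and a subgroup generated by some of the `w_s`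
-- contains no further generator.
--
-- INIP. The independent family lives in a group that is only known to be compactly generated. It is
-- pulled back to a compactly presented cover of that group, presented by the multiplication table
-- of a ball (`exists_compactlyPresented_cover`).

universe w'

open Topology SemidirectProduct

/-! ### The geometric representation of a Coxeter group -/

namespace CoxeterMatrix

variable {V : Type u} (μ : CoxeterMatrix V)

/-- The linear form `2 B(α_s, ·)` of the geometric representation. In a `CoxeterMatrix` the entry
`0` stands for `∞`, and the value `π / 0 = 0` gives the right form. -/
noncomputable def rootForm (s : V) : Module.Dual ℝ (V →₀ ℝ) :=
  Finsupp.linearCombination ℝ (fun t => -2 * Real.cos (Real.pi / μ s t))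

theorem rootForm_single (s t : V) :
    μ.rootForm s (Finsupp.single t 1) = -2 * Real.cos (Real.pi / μ s t) := by
  simp [rootForm]

theorem rootForm_self (s : V) : μ.rootForm s (Finsupp.single s 1) = 2 := by
  simp [rootForm_single]

/-- The reflection of the geometric representation that corresponds to `s`. -/
noncomputable def rootReflection (s : V) : (V →₀ ℝ) ≃ₗ[ℝ] (V →₀ ℝ) :=
  Module.reflection (μ.rootForm_self s)

-- The coefficients of a power of a product of two reflections are Chebyshev values `S_n(2 cos θ)`,
-- and `S_n(2 cos θ) sin θ = sin((n + 1)θ)`. For `θ = 2π / m` the coefficients in the `m`-th power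
-- cancel; `3 ≤ m` ensures `sin θ ≠ 0`.
open Polynomial.Chebyshev in
theorem rootReflection_mul_pow_of_three_le {s t : V} (h : 3 ≤ μ s t) :
    (μ.rootReflection s * μ.rootReflection t) ^ μ s t = 1 := by
  set m := μ s t with hm
  have hm' : μ t s = m := by rw [hm, μ.symmetric]
  set θ : ℝ := 2 * Real.pi / m with hθ
  have hmpos : (0 : ℝ) < m := by positivity
  have hmθ : m * θ = 2 * Real.pi := by rw [hθ]; field_simp
  have hsin : Real.sin θ ≠ 0 := by
    refine (Real.sin_pos_of_pos_of_lt_pi (by positivity) ?_).ne'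
    rw [hθ, div_lt_iff₀ hmpos, mul_comm]
    have : (3 : ℝ) ≤ m := by exact_mod_cast h
    nlinarith [Real.pi_pos]
  have ht : 2 * Real.cos θ = μ.rootForm s (Finsupp.single t 1) *
      μ.rootForm t (Finsupp.single s 1) - 2 := by
    rw [rootForm_single, rootForm_single, hm', ← hm, hθ,
      show 2 * Real.pi / m = 2 * (Real.pi / m) by ring, Real.cos_two_mul]
    ring
  -- Here `(n + 1)θ + (k + 1)θ = 2π`, so the two sines are opposite.
  have key : ∀ n k : ℤ, n + k + 2 = m →
      (S ℝ n).eval (2 * Real.cos θ) + (S ℝ k).eval (2 * Real.cos θ) = 0 := by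
    intro n k hnk
    have hnk' : (n : ℝ) + k + 2 = m := by exact_mod_cast hnk
    have : ((S ℝ n).eval (2 * Real.cos θ) + (S ℝ k).eval (2 * Real.cos θ)) * Real.sin θ = 0 := by
      rw [add_mul, S_two_mul_real_cos, S_two_mul_real_cos,
        show ((n : ℝ) + 1) * θ = 2 * Real.pi - (k + 1) * θ by rw [← hmθ, ← hnk']; ring,
        Real.sin_two_pi_sub]
      ring
    exact (mul_eq_zero.mp this).resolve_right hsin
  ext1 z
  rw [rootReflection, rootReflection, Module.reflection_mul_reflection_pow_apply _ _ _ _ _ ht]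
  obtain ⟨k, hk | hk⟩ : ∃ k : ℤ, (m : ℤ) = 2 * k ∨ (m : ℤ) = 2 * k + 1 :=
    ⟨m / 2, by omega⟩
  · have h0 := key (k - 1) (k - 1) (by omega)
    rw [show ((m : ℤ) - 2) / 2 = k - 1 by omega, show ((m : ℤ) - 1) / 2 = k - 1 by omega]
    have h1 : (S ℝ (k - 1)).eval (2 * Real.cos θ) = 0 := by linarith
    simp [h1]
  · have h0 := key (k - 1) k (by omega)
    rw [show ((m : ℤ) - 2) / 2 = k - 1 by omega, show ((m : ℤ) - 1) / 2 = k by omega,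
      show ((m : ℤ) - 3) / 2 = k - 1 by omega, show (m : ℤ) / 2 = k by omega,
      add_comm ((S ℝ k).eval _), h0]
    simp

theorem rootReflection_mul_self (s : V) : μ.rootReflection s * μ.rootReflection s = 1 := by
  ext1 z
  exact Module.involutive_reflection (μ.rootForm_self s) z

/-- Now `sin θ = 0`, but the roots are orthogonal, so the two reflections are commuting involutions.
-/
theorem rootReflection_mul_pow_of_eq_two {s t : V} (h : μ s t = 2) :
    (μ.rootReflection s * μ.rootReflection t) ^ μ s t = 1 := by
  have h' : μ t s = 2 := by rw [← h, μ.symmetric]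
  have hs : μ.rootForm s (Finsupp.single t 1) = 0 := by simp [rootForm_single, h]
  have ht : μ.rootForm t (Finsupp.single s 1) = 0 := by simp [rootForm_single, h']
  have hc : μ.rootReflection s * μ.rootReflection t =
      μ.rootReflection t * μ.rootReflection s := by
    ext1 z
    simp only [rootReflection, LinearEquiv.mul_apply, Module.reflection_apply, map_sub, map_smul,
      hs, ht]
    module
  rw [h, pow_two, mul_assoc, ← mul_assoc (μ.rootReflection t), ← hc, mul_assoc,
    rootReflection_mul_self, mul_one, rootReflection_mul_self]

theorem isLiftable_rootReflection : μ.IsLiftable μ.rootReflection := by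
  intro s t
  rcases lt_or_ge (μ s t) 3 with h | h
  · interval_cases hm : μ s t
    · simp
    · have : s = t := by
        by_contra hst
        exact μ.off_diagonal s t hst hm
      subst this
      rw [pow_one, rootReflection_mul_self]
    · rw [← hm, rootReflection_mul_pow_of_eq_two _ hm]
  · exact μ.rootReflection_mul_pow_of_three_le h

/-- The geometric representation of a Coxeter group. -/
noncomputable def geometricRep : μ.Group →* ((V →₀ ℝ) ≃ₗ[ℝ] (V →₀ ℝ)) :=
  μ.toCoxeterSystem.lift ⟨μ.rootReflection, μ.isLiftable_rootReflection⟩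

theorem geometricRep_simple (s : V) : μ.geometricRep (μ.simple s) = μ.rootReflection s :=
  μ.toCoxeterSystem.lift_apply_simple μ.isLiftable_rootReflection s

theorem simple_mul_self (s : V) : μ.simple s * μ.simple s = 1 :=
  μ.toCoxeterSystem.simple_mul_simple_self s

theorem simple_inv (s : V) : (μ.simple s)⁻¹ = μ.simple s :=
  μ.toCoxeterSystem.inv_simple s

theorem simple_mul_simple_pow (s t : V) : (μ.simple s * μ.simple t) ^ μ s t = 1 :=
  μ.toCoxeterSystem.simple_mul_simple_pow s t

theorem closure_range_simple : Subgroup.closure (Set.range μ.simple) = ⊤ :=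
  μ.toCoxeterSystem.subgroup_closure_range_simple

/-- The Chebyshev argument is `2` in this case, and `S_n(2) = n + 1`. Hence the coordinate at `t` of
the image of the root of `s` grows linearly in `k`. -/
theorem simple_mul_simple_pow_ne_one {s t : V} (h : μ s t = 0) {k : ℕ} (hk : k ≠ 0) :
    (μ.simple s * μ.simple t) ^ k ≠ 1 := by
  intro h1
  have hst : s ≠ t := by
    rintro rfl
    simp at h
  have h2 := congrArg (fun g => μ.geometricRep g (Finsupp.single s 1) t) h1
  have hf : μ.rootForm s (Finsupp.single t 1) = -2 := by simp [rootForm_single, h]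
  have hg : μ.rootForm t (Finsupp.single s 1) = -2 := by
    simp [rootForm_single, μ.symmetric t s, h]
  have ht : (2 : ℝ) = μ.rootForm s (Finsupp.single t 1) *
      μ.rootForm t (Finsupp.single s 1) - 2 := by
    rw [hf, hg]
    norm_num
  simp only [map_pow, map_mul, geometricRep_simple, rootReflection, map_one] at h2
  rw [Module.reflection_mul_reflection_pow_apply_self _ _ _ _ ht, hg,
    Polynomial.Chebyshev.S_eval_two, Polynomial.Chebyshev.S_eval_two] at h2
  simp [Finsupp.single_eq_of_ne hst.symm, hk] at h2

/-- For `v ∉ A`, the reflections indexed by `A` leave the coordinate at `v` unchanged, whereas the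
reflection of `v` negates its own root. -/
theorem mem_of_simple_mem_closure {A : Set V} {v : V}
    (h : μ.simple v ∈ Subgroup.closure (μ.simple '' A)) : v ∈ A := by
  by_contra hv
  have key : ∀ w ∈ Subgroup.closure (μ.simple '' A), ∀ z, μ.geometricRep w z v = z v := by
    intro w hw
    induction hw using Subgroup.closure_induction with
    | mem x hx =>
      obtain ⟨s, hs, rfl⟩ := hx
      intro z
      have hsv : v ≠ s := fun e => hv (e ▸ hs)
      simp [geometricRep_simple, rootReflection, Module.reflection_apply,
        Finsupp.single_eq_of_ne hsv]
    | one => simp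
    | mul x y _ _ hx hy => intro z; rw [map_mul, LinearEquiv.mul_apply, hx, hy]
    | inv x _ hx =>
      intro z
      rw [← hx, ← LinearEquiv.mul_apply, ← map_mul, mul_inv_cancel]
      simp
  have h1 := key _ h (Finsupp.single v 1)
  rw [geometricRep_simple, rootReflection, Module.reflection_apply_self] at h1
  norm_num at h1

theorem simple_injective : Function.Injective μ.simple := by
  intro s t h
  exact (μ.mem_of_simple_mem_closure (A := {t}) (v := s)
    (h ▸ Subgroup.subset_closure ⟨t, rfl, rfl⟩))

end CoxeterMatrix

/-! ### Word balls and the universal property behind compact presentations -/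

section Words

variable {G : Type w} [Group G] {Q : Type w'} [Group Q]

/-- The elements of a group that are products of at most `n` elements of `S`. -/
def wordBall (S : Set G) (n : ℕ) : Set G :=
  {g | ∃ l : List G, (∀ x ∈ l, x ∈ S) ∧ l.length ≤ n ∧ l.prod = g}

/-- A map between groups is multiplicative on words of length at most `n` with letters in `S`. -/
def MulOnWords (S : Set G) (n : ℕ) (φ : G → Q) : Prop :=
  ∀ l : List G, (∀ x ∈ l, x ∈ S) → l.length ≤ n → φ l.prod = (l.map φ).prod

/-- Every map which is multiplicative on words of length at most `n` with letters in `S` agrees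
on `S` with a homomorphism. -/
def PresentedByWords (S : Set G) (n : ℕ) : Prop :=
  ∀ (Q : Type w') [Group Q] (φ : G → Q), MulOnWords S n φ → ∃ f : G →* Q, ∀ s ∈ S, f s = φ s

theorem MulOnWords.mono {S T : Set G} {m n : ℕ} {φ : G → Q} (h : MulOnWords T n φ) (hST : S ⊆ T)
    (hmn : m ≤ n) : MulOnWords S m φ :=
  fun l hl hlen => h l (fun x hx => hST (hl x hx)) (hlen.trans hmn)

theorem MulOnWords.map_one {S : Set G} {n : ℕ} {φ : G → Q} (h : MulOnWords S n φ) : φ 1 = 1 := by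
  simpa using h [] (by simp) (by simp)

theorem MulOnWords.map_inv {S : Set G} {n : ℕ} {φ : G → Q} (h : MulOnWords S n φ) (hn : 2 ≤ n)
    {x : G} (hx : x ∈ S) (hx' : x⁻¹ ∈ S) : φ x⁻¹ = (φ x)⁻¹ := by
  have := h [x, x⁻¹] (by simp [hx, hx']) (by simpa using hn)
  simp only [List.prod_cons, List.prod_nil, mul_one, mul_inv_cancel, List.map_cons, List.map_nil,
    h.map_one] at this
  exact eq_inv_of_mul_eq_one_right this.symm

theorem PresentedByWords.mono {S : Set G} {m n : ℕ} (h : PresentedByWords.{w, w'} S m)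
    (hmn : m ≤ n) : PresentedByWords.{w, w'} S n :=
  fun Q _ φ hφ => h Q φ (hφ.mono subset_rfl hmn)

theorem one_mem_wordBall (S : Set G) (n : ℕ) : (1 : G) ∈ wordBall S n := ⟨[], by simp⟩

theorem subset_wordBall (S : Set G) {n : ℕ} (hn : 1 ≤ n) : S ⊆ wordBall S n :=
  fun x hx => ⟨[x], by simpa using hx, by simpa using hn, by simp⟩

theorem wordBall_mono_right (S : Set G) : Monotone (wordBall S) :=
  fun _ _ h _ ⟨l, h1, h2, h3⟩ => ⟨l, h1, h2.trans h, h3⟩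

theorem mul_mem_wordBall {S : Set G} {m n : ℕ} {x y : G} (hx : x ∈ wordBall S m)
    (hy : y ∈ wordBall S n) : x * y ∈ wordBall S (m + n) := by
  obtain ⟨l, h1, h2, rfl⟩ := hx
  obtain ⟨l', h1', h2', rfl⟩ := hy
  refine ⟨l ++ l', fun z hz => ?_, by simp; omega, by simp⟩
  rcases List.mem_append.mp hz with h | h
  exacts [h1 z h, h1' z h]

theorem inv_mem_wordBall {S : Set G} (hS : ∀ x ∈ S, x⁻¹ ∈ S) {n : ℕ} {x : G}
    (hx : x ∈ wordBall S n) : x⁻¹ ∈ wordBall S n := by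
  obtain ⟨l, h1, h2, rfl⟩ := hx
  refine ⟨(l.map (·⁻¹)).reverse, fun z hz => ?_, by simpa using h2, (List.prod_inv_reverse l).symm⟩
  simp only [List.mem_reverse, List.mem_map] at hz
  obtain ⟨y, hy, rfl⟩ := hz
  exact hS y (h1 y hy)

open scoped Pointwise in
theorem wordBall_succ (S : Set G) (n : ℕ) :
    wordBall S (n + 1) = wordBall S n ∪ S * wordBall S n := by
  ext g
  constructor
  · rintro ⟨l, h1, h2, rfl⟩
    cases l with
    | nil => exact Or.inl (one_mem_wordBall S n)
    | cons a l =>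
      refine Or.inr ⟨a, h1 a (by simp), l.prod, ⟨l, fun x hx => h1 x (by simp [hx]), ?_, rfl⟩, ?_⟩
      · simpa using h2
      · simp
  · rintro (h | ⟨a, ha, b, hb, rfl⟩)
    · exact wordBall_mono_right S n.le_succ h
    · rw [add_comm]
      exact mul_mem_wordBall (subset_wordBall S le_rfl ha) hb

theorem exists_mem_wordBall {S : Set G} (hS : ∀ x ∈ S, x⁻¹ ∈ S) (hgen : Subgroup.closure S = ⊤)
    (g : G) : ∃ n, g ∈ wordBall S n := by
  have hg : g ∈ Subgroup.closure S := hgen ▸ Subgroup.mem_top g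
  induction hg using Subgroup.closure_induction with
  | mem x hx => exact ⟨1, subset_wordBall S le_rfl hx⟩
  | one => exact ⟨0, one_mem_wordBall S 0⟩
  | mul x y _ _ hx hy =>
    obtain ⟨m, hm⟩ := hx
    obtain ⟨n, hn⟩ := hy
    exact ⟨m + n, mul_mem_wordBall hm hn⟩
  | inv x _ hx => exact hx.imp fun _ h => inv_mem_wordBall hS h

theorem MulOnWords.eq_of_mem_wordBall {S : Set G} {n : ℕ} {φ : G → Q} (h : MulOnWords S n φ)
    {f : G →* Q} (hf : ∀ s ∈ S, f s = φ s) {g : G} (hg : g ∈ wordBall S n) : f g = φ g := by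
  obtain ⟨l, h1, h2, rfl⟩ := hg
  rw [h l h1 h2, map_list_prod]
  exact congrArg List.prod (List.map_congr_left fun x hx => hf x (h1 x hx))

theorem PresentedByWords.superset {S T : Set G} {m n : ℕ} (h : PresentedByWords.{w, w'} S n)
    (hST : S ⊆ T) (hT : T ⊆ wordBall S m) : PresentedByWords.{w, w'} T (max m n) := by
  intro Q _ φ hφ
  obtain ⟨f, hf⟩ := h Q φ (hφ.mono hST (le_max_right _ _))
  exact ⟨f, fun t ht => (hφ.mono hST (le_max_left _ _)).eq_of_mem_wordBall hf (hT ht)⟩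

variable [TopologicalSpace G]

theorem isCompact_wordBall [ContinuousMul G] {S : Set G} (hS : IsCompact S) (n : ℕ) :
    IsCompact (wordBall S n) := by
  induction n with
  | zero =>
    convert isCompact_singleton (x := (1 : G))
    ext g
    constructor
    · rintro ⟨l, -, h2, rfl⟩
      simp [List.eq_nil_of_length_eq_zero (Nat.le_zero.mp h2)]
    · rintro rfl
      exact one_mem_wordBall S 0
  | succ n ih =>
    rw [wordBall_succ]
    exact ih.union (hS.mul ih)

/-- By Baire, one of the closed word balls has interior. Translating it puts every point in the
interior of some ball, and compactness picks a single radius. -/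
theorem IsCompact.exists_subset_wordBall [IsTopologicalGroup G] [LocallyCompactSpace G]
    [T2Space G] {S : Set G} (hSc : IsCompact S) (hS : ∀ x ∈ S, x⁻¹ ∈ S)
    (hgen : Subgroup.closure S = ⊤) {K : Set G} (hK : IsCompact K) : ∃ m, K ⊆ wordBall S m := by
  have hcov : ⋃ n, wordBall S n = Set.univ :=
    Set.eq_univ_of_forall fun g => Set.mem_iUnion.mpr (exists_mem_wordBall hS hgen g)
  obtain ⟨n, x, hx⟩ := nonempty_interior_of_iUnion_of_closed
    (fun n => (isCompact_wordBall hSc n).isClosed) hcov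
  have hint : ∀ g : G, ∃ m, g ∈ interior (wordBall S m) := by
    intro g
    obtain ⟨m, hm⟩ := exists_mem_wordBall hS hgen (g * x⁻¹)
    refine ⟨m + n, mem_interior.mpr
      ⟨(fun y => (g * x⁻¹)⁻¹ * y) ⁻¹' interior (wordBall S n), fun y hy => ?_,
        isOpen_interior.preimage (continuous_const_mul _), by simpa using hx⟩⟩
    have := mul_mem_wordBall hm (interior_subset hy)
    rwa [mul_inv_cancel_left] at this
  obtain ⟨m, hm⟩ := hK.elim_directed_cover (fun m => interior (wordBall S m))
    (fun _ => isOpen_interior) (fun g _ => Set.mem_iUnion.mpr (hint g))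
    (Monotone.directed_le fun a b hab => interior_mono (wordBall_mono_right S hab))
  exact ⟨m, hm.trans interior_subset⟩

theorem IsCompactlyGeneratedGroup.exists_symmetric [ContinuousInv G]
    (h : IsCompactlyGeneratedGroup G) {K : Set G} (hK : IsCompact K) :
    ∃ S : Set G, IsCompact S ∧ (∀ x ∈ S, x⁻¹ ∈ S) ∧ Subgroup.closure S = ⊤ ∧ K ⊆ S := by
  obtain ⟨S, hS, hgen⟩ := h
  refine ⟨(S ∪ K) ∪ (S ∪ K)⁻¹, (hS.union hK).union (hS.union hK).inv, ?_, ?_, ?_⟩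
  · rintro x (hx | hx)
    · exact Or.inr (by simpa using hx)
    · exact Or.inl hx
  · rw [eq_top_iff, ← hgen]
    exact Subgroup.closure_mono fun x hx => Or.inl (Or.inl hx)
  · exact fun x hx => Or.inl (Or.inr hx)

/-- The relators are all words of length at most `2n` that hold in `G`; they identify any two words
of length at most `n` with equal value. Short products therefore map consistently to the quotient of
the free group, and the universal property extends this to a homomorphism through which the quotient
map factors. -/
theorem PresentedByWords.isCompactlyPresentedGroup {S : Set G} {n : ℕ} (hS : IsCompact S)
    (hgen : Subgroup.closure S = ⊤) (hn : 1 ≤ n) (h : PresentedByWords.{w, w} S n) :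
    IsCompactlyPresentedGroup G := by
  classical
  set R : Set (FreeGroup S) := {r | (∃ l : List (S × Bool), l.length ≤ n + n ∧ FreeGroup.mk l = r) ∧
    FreeGroup.lift (Subtype.val : S → G) r = 1} with hR
  refine ⟨S, hS, hgen, R, n + n, fun r hr => hr.1, le_antisymm
    (Subgroup.normalClosure_le_normal fun r hr => hr.2) ?_⟩
  let q := QuotientGroup.mk' (Subgroup.normalClosure R)
  let F : List S → FreeGroup S := fun l => FreeGroup.mk (l.map fun s => (s, true))
  have hF : ∀ l, FreeGroup.lift (Subtype.val : S → G) (F l) = (l.map Subtype.val).prod := by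
    intro l
    simp [F, FreeGroup.lift_mk, Function.comp_def]
  have hFapp : ∀ l l', F (l ++ l') = F l * F l' := by simp [F, FreeGroup.mul_mk]
  have key : ∀ l l' : List S, l.length ≤ n → l'.length ≤ n →
      (l.map Subtype.val).prod = (l'.map Subtype.val).prod → q (F l) = q (F l') := by
    intro l l' hl hl' heq
    rw [← mul_inv_eq_one, ← map_inv, ← map_mul]
    refine (QuotientGroup.eq_one_iff _).mpr (Subgroup.subset_normalClosure ⟨?_, ?_⟩)
    · refine ⟨(l.map fun s => (s, true)) ++ FreeGroup.invRev (l'.map fun s => (s, true)), ?_, ?_⟩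
      · simp [FreeGroup.invRev_length]
        omega
      · rw [← FreeGroup.mul_mk, ← FreeGroup.inv_mk]
    · rw [map_mul, map_inv, hF, hF, heq, mul_inv_cancel]
  -- The value `1` outside the ball is irrelevant: only words of length at most `n` are tested.
  let φ : G → FreeGroup S ⧸ Subgroup.normalClosure R := fun g =>
    if hg : ∃ l : List S, l.length ≤ n ∧ (l.map Subtype.val).prod = g then q (F hg.choose) else 1
  have hφ : ∀ l : List S, l.length ≤ n → φ (l.map Subtype.val).prod = q (F l) := by
    intro l hl
    have hg : ∃ l' : List S, l'.length ≤ n ∧ (l'.map Subtype.val).prod =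
      (l.map Subtype.val).prod := ⟨l, hl, rfl⟩
    simp only [φ, dif_pos hg]
    exact key _ _ hg.choose_spec.1 hl hg.choose_spec.2
  have hφS : ∀ s : S, φ s = q (FreeGroup.of s) := fun s => by
    simpa [F, FreeGroup.of] using hφ [s] (by simpa using hn)
  obtain ⟨f, hf⟩ := h _ φ (by
    intro l hl hlen
    lift l to List S using hl
    rw [hφ l (by simpa using hlen), List.map_map]
    have : ∀ l : List S, q (F l) = (l.map (φ ∘ Subtype.val)).prod := by
      intro l
      induction l with
      | nil => simp [F, ← FreeGroup.one_eq_mk]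
      | cons a l ih =>
        have := hFapp [a] l
        rw [List.singleton_append] at this
        rw [this, map_mul, ih, List.map_cons, List.prod_cons, Function.comp_apply, hφS]
        rfl
    exact this l)
  have hcomp : f.comp (FreeGroup.lift (Subtype.val : S → G)) = q := by
    refine FreeGroup.ext_hom _ _ fun s => ?_
    simp [hf s s.2, hφS]
  intro x hx
  refine (QuotientGroup.eq_one_iff x).mp ?_
  change q x = 1
  rw [← hcomp, MonoidHom.comp_apply, MonoidHom.mem_ker.mp hx, map_one]

theorem IsCompactlyPresentedGroup.exists_presentedByWords [IsTopologicalGroup G]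
    [LocallyCompactSpace G] [T2Space G] (h : IsCompactlyPresentedGroup G) {K : Set G}
    (hK : IsCompact K) : ∃ (S : Set G) (n : ℕ), IsCompact S ∧ (∀ x ∈ S, x⁻¹ ∈ S) ∧
      Subgroup.closure S = ⊤ ∧ K ⊆ S ∧ PresentedByWords.{w, w'} S n := by
  obtain ⟨S, hS, hgen, R, n, hR, hker⟩ := h
  set T := S ∪ S⁻¹ with hT
  have hTinv : ∀ x ∈ T, x⁻¹ ∈ T := by
    rintro x (hx | hx)
    · exact Or.inr (by simpa using hx)
    · exact Or.inl hx
  have hTgen : Subgroup.closure T = ⊤ := by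
    rw [eq_top_iff, ← hgen]
    exact Subgroup.closure_mono Set.subset_union_left
  have hTc : IsCompact T := hS.union hS.inv
  -- Relators of length at most `n` are words in `S ∪ S⁻¹` of that length. The extra `2` admits the
  -- word `x x⁻¹`, which makes `φ` respect inverses.
  have hpres : PresentedByWords.{w, w'} T (n + 2) := by
    intro Q _ φ hφ
    set p := FreeGroup.lift (Subtype.val : S → G)
    set ψ := FreeGroup.lift (fun s : S => φ s)
    have hsurj : Function.Surjective p := by
      rw [← MonoidHom.range_eq_top, FreeGroup.range_lift_eq_closure, Subtype.range_coe, hgen]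
    have hle : p.ker ≤ ψ.ker := by
      rw [← hker]
      refine Subgroup.normalClosure_le_normal fun r hr => ?_
      obtain ⟨l, hl, rfl⟩ := hR r hr
      have h1 : p (FreeGroup.mk l) = 1 := by
        rw [← MonoidHom.mem_ker, ← hker]
        exact Subgroup.subset_normalClosure hr
      rw [SetLike.mem_coe, MonoidHom.mem_ker]
      rw [FreeGroup.lift_mk] at h1 ⊢
      have h2 := hφ (l.map fun x => cond x.2 (x.1 : G) (x.1 : G)⁻¹) (by
        intro x hx
        obtain ⟨⟨s, b⟩, -, rfl⟩ := List.mem_map.mp hx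
        cases b
        · exact Or.inr (by simp)
        · exact Or.inl s.2) (by simp; omega)
      rw [h1, hφ.map_one, List.map_map] at h2
      rw [h2]
      refine congrArg List.prod (List.map_congr_left ?_)
      rintro ⟨s, b⟩ -
      cases b
      · exact (hφ.map_inv (by omega) (Or.inl s.2) (hTinv _ (Or.inl s.2))).symm
      · rfl
    refine ⟨MonoidHom.liftOfSurjective p hsurj ⟨ψ, hle⟩, ?_⟩
    have hS' : ∀ s ∈ S, MonoidHom.liftOfSurjective p hsurj ⟨ψ, hle⟩ s = φ s := by
      intro s hs
      have := MonoidHom.liftOfRightInverse_comp_apply p _ (Function.rightInverse_surjInv hsurj)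
        ⟨ψ, hle⟩ (FreeGroup.of ⟨s, hs⟩)
      simpa [p, ψ] using this
    rintro s (hs | hs)
    · exact hS' s hs
    · have := hS' s⁻¹ hs
      rw [_root_.map_inv] at this
      rw [← inv_inj, this, hφ.map_inv (by omega) (Or.inr hs) (Or.inl hs)]
  obtain ⟨m, hm⟩ := hTc.exists_subset_wordBall hTinv hTgen (hTc.union (hK.union hK.inv))
  refine ⟨T ∪ (K ∪ K⁻¹), _, hTc.union (hK.union hK.inv), ?_, ?_, ?_,
    hpres.superset Set.subset_union_left hm⟩
  · rintro x (hx | hx | hx)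
    · exact Or.inl (hTinv x hx)
    · exact Or.inr (Or.inr (by simpa using hx))
    · exact Or.inr (Or.inl hx)
  · rw [eq_top_iff, ← hTgen]
    exact Subgroup.closure_mono Set.subset_union_left
  · exact fun x hx => Or.inr (Or.inl hx)

theorem IsCompactlyPresentedGroup.isCompactlyGeneratedGroup (h : IsCompactlyPresentedGroup G) :
    IsCompactlyGeneratedGroup G :=
  h.imp fun _ hS => ⟨hS.1, hS.2.1⟩

end Words

/-! ### Kernels of quotient maps onto compactly presented groups -/

theorem Subgroup.exists_finset_subset_iSup {G ι : Type*} [Group G] (N : ι → Subgroup G) {F : Set G}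
    (hF : F.Finite) (hFN : F ⊆ (⨆ i, N i : Subgroup G)) :
    ∃ t : Finset ι, F ⊆ (⨆ i ∈ t, N i : Subgroup G) := by
  classical
  have hdir : Monotone fun t : Finset ι => ⨆ i ∈ t, N i :=
    fun s t hst => biSup_mono fun i hi => hst hi
  induction F, hF using Set.Finite.induction_on with
  | empty => exact ⟨∅, Set.empty_subset _⟩
  | @insert a F _ _ ih =>
    obtain ⟨t, ht⟩ := ih fun x hx => hFN (Or.inr hx)
    have ha := hFN (Set.mem_insert a F)
    rw [iSup_eq_iSup_finset, SetLike.mem_coe,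
      Subgroup.mem_iSup_of_directed hdir.directed_le] at ha
    obtain ⟨t', ht'⟩ := ha
    refine ⟨t ∪ t', ?_⟩
    rintro x (rfl | hx)
    · exact hdir Finset.subset_union_right ht'
    · exact hdir Finset.subset_union_left (ht hx)

section Quotients

variable {G : Type w} [Group G] [TopologicalSpace G] [IsTopologicalGroup G]
  [LocallyCompactSpace G] [T2Space G]

/-- A retract of a compactly presented group is compactly presented. -/
theorem IsCompactlyPresentedGroup.of_retract {H : Type w'} [Group H] [TopologicalSpace H]
    (h : IsCompactlyPresentedGroup G) (i : H →* G) (r : G →* H) (hi : Continuous i)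
    (hr : Continuous r) (hri : ∀ x, r (i x) = x) : IsCompactlyPresentedGroup H := by
  obtain ⟨S, n, hSc, hS, hgen, -, hpres⟩ :=
    h.exists_presentedByWords.{w, w'} (K := ∅) isCompact_empty
  -- The set is made stable under `i ∘ r`, so that the homomorphism obtained from `φ ∘ r` has a
  -- known value at `i (r t)`.
  set T : Set G := S ∪ i ∘ r '' S with hT
  have hTc : IsCompact T := hSc.union (hSc.image (hi.comp hr))
  obtain ⟨m, hm⟩ := hSc.exists_subset_wordBall hS hgen hTc
  have hpresT := (hpres.superset Set.subset_union_left hm).mono (le_max_left _ 1)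
  have hTir : ∀ t ∈ T, i (r t) ∈ T := by
    rintro _ (hs | ⟨s, hs, rfl⟩)
    · exact Or.inr ⟨_, hs, rfl⟩
    · exact Or.inr ⟨s, hs, by simp [hri]⟩
  refine PresentedByWords.isCompactlyPresentedGroup (hTc.image hr) ?_ (le_max_right _ _)
    (S := r '' T) (n := max (max m n) 1) fun Q _ φ hφ => ?_
  · rw [← MonoidHom.map_closure, eq_top_iff]
    intro x _
    refine ⟨i x, Subgroup.closure_mono Set.subset_union_left ?_, hri x⟩
    rw [hgen]
    exact Subgroup.mem_top _
  · obtain ⟨f, hf⟩ := hpresT Q (φ ∘ r) (fun l hl hlen => by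
      have := hφ (l.map r) (by
        intro x hx
        obtain ⟨y, hy, rfl⟩ := List.mem_map.mp hx
        exact ⟨y, hl y hy, rfl⟩) (by simpa using hlen)
      simpa [Function.comp_apply, map_list_prod] using this)
    refine ⟨f.comp i, ?_⟩
    rintro _ ⟨t, ht, rfl⟩
    rw [MonoidHom.comp_apply, hf _ (hTir t ht), Function.comp_apply, hri]

theorem IsOpenQuotientMap.exists_isCompact_subset_image {X Y : Type*} [TopologicalSpace X]
    [TopologicalSpace Y] [LocallyCompactSpace X] {π : X → Y} (hπ : IsOpenQuotientMap π)
    {K : Set Y} (hK : IsCompact K) : ∃ L : Set X, IsCompact L ∧ K ⊆ π '' L := by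
  choose σ hσ using hπ.surjective
  choose C hC hCσ using fun x : X => exists_compact_mem_nhds x
  obtain ⟨t, -, ht⟩ := hK.elim_nhds_subcover (fun y => π '' C (σ y)) (fun y _ => by
    have := hπ.isOpenMap.image_mem_nhds (hCσ (σ y))
    rwa [hσ] at this)
  refine ⟨⋃ y ∈ t, C (σ y), t.isCompact_biUnion fun y _ => hC _, ?_⟩
  rwa [Set.image_iUnion₂]

/-- Lifting short words from `G` to `G₀` is ambiguous only up to quotients of two short words that
lie in the kernel. Once this compact set of ambiguities is killed, lifting is well defined on short
words and extends to all of `G`; so the whole kernel has been killed. -/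
theorem IsCompactlyPresentedGroup.exists_ker_le_normalClosure {G₀ : Type w'} [Group G₀]
    [TopologicalSpace G₀] [IsTopologicalGroup G₀] [LocallyCompactSpace G₀]
    (h : IsCompactlyPresentedGroup G) (h₀ : IsCompactlyGeneratedGroup G₀) {π : G₀ →* G}
    (hπ : IsOpenQuotientMap π) :
    ∃ K : Set G₀, IsCompact K ∧ π.ker ≤ Subgroup.normalClosure (K ∩ π.ker) := by
  classical
  obtain ⟨S, n, hSc, hS, hgen, -, hpres⟩ :=
    h.exists_presentedByWords.{w, w'} (K := ∅) isCompact_empty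
  obtain ⟨S₀, hS₀c, hS₀gen⟩ := h₀
  obtain ⟨L, hL, hSL⟩ := hπ.exists_isCompact_subset_image hSc
  set T := S₀ ∪ L with hT
  have hTc : IsCompact T := hS₀c.union hL
  have hST : S ⊆ π '' T := hSL.trans (Set.image_mono Set.subset_union_right)
  obtain ⟨m, hm⟩ := hSc.exists_subset_wordBall hS hgen (hTc.image hπ.continuous)
  obtain ⟨N, hN, hpresT⟩ : ∃ N, 1 ≤ N ∧ PresentedByWords.{w, w'} (π '' T) N :=
    ⟨_, le_max_right _ _, (hpres.superset hST hm).mono (le_max_left _ 1)⟩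
  have hW := isCompact_wordBall hTc N
  set W := wordBall T N
  refine ⟨(fun p : G₀ × G₀ => p.1⁻¹ * p.2) '' (W ×ˢ W),
    (hW.prod hW).image (by fun_prop), ?_⟩
  set K := (fun p : G₀ × G₀ => p.1⁻¹ * p.2) '' (W ×ˢ W)
  let q := QuotientGroup.mk' (Subgroup.normalClosure (K ∩ π.ker))
  let φ : G → G₀ ⧸ Subgroup.normalClosure (K ∩ π.ker) := fun g =>
    if hg : ∃ x ∈ W, π x = g then q hg.choose else 1
  have hφ : ∀ x ∈ W, φ (π x) = q x := by
    intro x hx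
    have hg : ∃ y ∈ W, π y = π x := ⟨x, hx, rfl⟩
    simp only [φ, dif_pos hg]
    refine QuotientGroup.eq.mpr (Subgroup.subset_normalClosure
      ⟨⟨(hg.choose, x), ⟨hg.choose_spec.1, hx⟩, rfl⟩, ?_⟩)
    simp [MonoidHom.mem_ker, hg.choose_spec.2]
  have hφT : ∀ x ∈ T, φ (π x) = q x := fun x hx => hφ x (subset_wordBall T hN hx)
  obtain ⟨f, hf⟩ := hpresT _ φ (by
    intro l hl hlen
    choose! τ hτ hπτ using (fun x hx => hl x hx : ∀ x ∈ l, ∃ t, t ∈ T ∧ π t = x)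
    have hl' : l = (l.map τ).map π := by
      rw [List.map_map]
      conv_lhs => rw [← List.map_id l]
      exact List.map_congr_left fun x hx => (hπτ x hx).symm
    have hτT : ∀ x ∈ l.map τ, x ∈ T := by
      intro x hx
      obtain ⟨y, hy, rfl⟩ := List.mem_map.mp hx
      exact hτ y hy
    have h1 : l.map φ = (l.map τ).map q := by
      conv_lhs => rw [hl']
      rw [List.map_map]
      exact List.map_congr_left fun x hx => hφT x (hτT x hx)
    have h2 : l.prod = π (l.map τ).prod := by
      conv_lhs => rw [hl']
      rw [map_list_prod]
    rw [h1, h2, hφ _ ⟨l.map τ, hτT, by simpa using hlen, rfl⟩, map_list_prod])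
  have hcomp : f.comp π = q := MonoidHom.eq_of_eqOn_dense hS₀gen fun x hx => by
    rw [MonoidHom.comp_apply, hf _ ⟨x, Or.inl hx, rfl⟩, hφT x (Or.inl hx)]
  intro x hx
  refine (QuotientGroup.eq_one_iff x).mp ?_
  change q x = 1
  rw [← hcomp, MonoidHom.comp_apply, MonoidHom.mem_ker.mp hx, map_one]

/-- The compact set that normally generates a discrete kernel meets it in a finite set, and each
element of that set involves finitely many of the `N i`. -/
theorem IsCompactlyPresentedGroup.exists_finset_ker_le {G₀ : Type w'} [Group G₀]
    [TopologicalSpace G₀] [IsTopologicalGroup G₀] [LocallyCompactSpace G₀] [T2Space G₀]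
    (h : IsCompactlyPresentedGroup G) (h₀ : IsCompactlyGeneratedGroup G₀) {π : G₀ →* G}
    (hπ : IsOpenQuotientMap π) [hdisc : DiscreteTopology π.ker] {ι : Type*} (N : ι → Subgroup G₀)
    [∀ i, (N i).Normal] (hN : π.ker ≤ ⨆ i, N i) : ∃ t : Finset ι, π.ker ≤ ⨆ i ∈ t, N i := by
  obtain ⟨K, hK, hle⟩ := h.exists_ker_le_normalClosure h₀ hπ
  have hclosed : IsClosed (π.ker : Set G₀) := by
    rw [MonoidHom.coe_ker]
    exact isClosed_singleton.preimage hπ.continuous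
  have hfin : (K ∩ π.ker).Finite :=
    (hK.inter_right hclosed).finite (IsDiscrete.mono ⟨hdisc⟩ Set.inter_subset_right)
  obtain ⟨t, ht⟩ := Subgroup.exists_finset_subset_iSup N hfin fun x hx => hN hx.2
  have hnorm : (⨆ i ∈ t, N i : Subgroup G₀).Normal :=
    Subgroup.biSup_normal (t : Set ι) N fun i _ => inferInstance
  exact ⟨t, hle.trans (Subgroup.normalClosure_le_normal ht)⟩

/-- The quotient of a compactly generated locally compact group by a discrete normal subgroup
that is generated by an infinite independent family of normal subgroups is not compactly
presented. -/
theorem not_isCompactlyPresentedGroup_of_independentSubgroups {G₀ : Type w'} [Group G₀]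
    [TopologicalSpace G₀] [IsTopologicalGroup G₀] [LocallyCompactSpace G₀] [T2Space G₀]
    (h₀ : IsCompactlyGeneratedGroup G₀) {π : G₀ →* G} (hπ : IsOpenQuotientMap π)
    [hdisc : DiscreteTopology π.ker] {ι : Type w'} [Infinite ι] (N : ι → Subgroup G₀)
    [∀ i, (N i).Normal] (hind : IndependentSubgroups N) (hN : ⨆ i, N i = π.ker) :
    ¬ IsCompactlyPresentedGroup G := by
  intro h
  obtain ⟨t, ht⟩ := h.exists_finset_ker_le h₀ hπ N hN.ge
  obtain ⟨i, hi⟩ := Infinite.exists_notMem_finset t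
  refine hind i (((le_iSup N i).trans (hN.le.trans ht)).trans (iSup₂_le fun j hj => ?_))
  exact le_iSup (fun j : {j : ι // j ≠ i} => N j) ⟨j, fun e => hi (e ▸ hj)⟩

end Quotients

/-! ### Discrete subgroups and compactly presented covers -/

theorem Subgroup.discreteTopology_of_mem_nhds_one {G : Type*} [Group G] [TopologicalSpace G]
    [IsTopologicalGroup G] (N : Subgroup G) {U : Set G} (hU : U ∈ 𝓝 (1 : G))
    (h : ∀ x ∈ U, x ∈ N → x = 1) : DiscreteTopology N := by
  refine discreteTopology_of_isOpen_singleton_one (isOpen_iff_mem_nhds.mpr ?_)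
  rintro _ rfl
  exact (mem_nhds_subtype _ _ _).mpr ⟨U, hU, fun x hx => Subtype.ext (h x hx x.2)⟩

theorem Subgroup.exists_mem_nhds_one_of_discreteTopology {G : Type*} [Group G]
    [TopologicalSpace G] (N : Subgroup G) [DiscreteTopology N] :
    ∃ U ∈ 𝓝 (1 : G), ∀ x ∈ U, x ∈ N → x = 1 := by
  obtain ⟨U, hU, h⟩ := (mem_nhds_subtype _ _ _).mp
    ((isOpen_discrete ({1} : Set N)).mem_nhds rfl)
  exact ⟨U, hU, fun x hx hxN => congrArg Subtype.val (h (show (⟨x, hxN⟩ : N) ∈ _ from hx))⟩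

section LocalCover

variable {G : Type w} [Group G]

/-- The relations `a * b = c` among the products of at most three elements of `C`. -/
def localRelations (C : Set G) : Set (FreeGroup (wordBall C 3)) :=
  {r | ∃ a b c : wordBall C 3, (a : G) * b = c ∧
    r = FreeGroup.of a * FreeGroup.of b * (FreeGroup.of c)⁻¹}

/-- The group generated by the products of at most three elements of `C`, subject to the relations
`a * b = c` that hold among them in `G`. -/
abbrev LocalCover (C : Set G) : Type w := PresentedGroup (localRelations C)

namespace LocalCover

variable {C : Set G}

open Classical in
/-- The partial section of the projection of a local cover to the group. -/
noncomputable def sec (C : Set G) (g : G) : LocalCover C :=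
  if h : g ∈ wordBall C 3 then PresentedGroup.of ⟨g, h⟩ else 1

theorem sec_of_mem {a : G} (ha : a ∈ wordBall C 3) : sec C a = PresentedGroup.of ⟨a, ha⟩ :=
  dif_pos ha

theorem sec_mul {a b : G} (ha : a ∈ wordBall C 3) (hb : b ∈ wordBall C 3)
    (hab : a * b ∈ wordBall C 3) : sec C (a * b) = sec C a * sec C b := by
  rw [sec_of_mem ha, sec_of_mem hb, sec_of_mem hab, eq_comm, ← mul_inv_eq_one]
  exact PresentedGroup.one_of_mem (rels := localRelations C)
    ⟨⟨a, ha⟩, ⟨b, hb⟩, ⟨a * b, hab⟩, rfl, rfl⟩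

/-- A map which is multiplicative where products stay in the ball extends to the local cover. -/
def lift {Q : Type w'} [Group Q] (φ : G → Q) (hφ : ∀ a b : G, a ∈ wordBall C 3 →
    b ∈ wordBall C 3 → a * b ∈ wordBall C 3 → φ (a * b) = φ a * φ b) : LocalCover C →* Q :=
  PresentedGroup.toGroup (f := fun a : wordBall C 3 => φ a) (by
    rintro _ ⟨a, b, c, h, rfl⟩
    have h1 := hφ a b a.2 b.2 (h ▸ c.2)
    simp [← h, h1])

theorem lift_sec {Q : Type w'} [Group Q] (φ : G → Q) (hφ : ∀ a b : G, a ∈ wordBall C 3 →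
    b ∈ wordBall C 3 → a * b ∈ wordBall C 3 → φ (a * b) = φ a * φ b) {a : G}
    (ha : a ∈ wordBall C 3) : lift φ hφ (sec C a) = φ a := by
  rw [sec_of_mem ha]
  exact PresentedGroup.toGroup.of _

/-- The projection of a local cover to the group. -/
def proj (C : Set G) : LocalCover C →* G := lift id fun _ _ _ _ _ => rfl

theorem proj_sec {a : G} (ha : a ∈ wordBall C 3) : proj C (sec C a) = a := lift_sec _ _ ha

theorem sec_one : sec C 1 = 1 := by
  have h := sec_mul (one_mem_wordBall C 3) (one_mem_wordBall C 3)
    (by rw [mul_one]; exact one_mem_wordBall C 3)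
  rw [mul_one] at h
  exact left_eq_mul.mp h

theorem sec_inv (hinv : ∀ x ∈ C, x⁻¹ ∈ C) {a : G} (ha : a ∈ wordBall C 3) :
    sec C a⁻¹ = (sec C a)⁻¹ := by
  have h := sec_mul ha (inv_mem_wordBall hinv ha)
    (by rw [mul_inv_cancel]; exact one_mem_wordBall C 3)
  rw [mul_inv_cancel, sec_one] at h
  exact eq_inv_of_mul_eq_one_right h.symm

theorem mulOnWords_sec : MulOnWords C 3 (sec C) := by
  intro l
  induction l with
  | nil => intros; exact sec_one
  | cons a l ih =>
    intro hl hlen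
    rw [List.length_cons] at hlen
    have hl' : ∀ x ∈ l, x ∈ C := fun x hx => hl x (List.mem_cons_of_mem _ hx)
    have h := ih hl' (by omega)
    rw [List.prod_cons, List.map_cons, List.prod_cons, ← h]
    refine sec_mul (subset_wordBall C (by norm_num) (hl a (by simp))) ⟨l, hl', by omega, rfl⟩
      ⟨a :: l, hl, by simpa using hlen, by simp⟩

theorem closure_image_sec : Subgroup.closure (sec C '' C) = ⊤ := by
  rw [eq_top_iff, ← PresentedGroup.closure_range_of, Subgroup.closure_le]
  rintro _ ⟨⟨d, hd⟩, rfl⟩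
  rw [← sec_of_mem hd]
  obtain ⟨l, hl, hlen, rfl⟩ := hd
  rw [SetLike.mem_coe, mulOnWords_sec l hl hlen]
  refine Subgroup.list_prod_mem _ fun x hx => ?_
  obtain ⟨y, hy, rfl⟩ := List.mem_map.mp hx
  exact Subgroup.subset_closure ⟨y, hl y hy, rfl⟩

theorem proj_surjective (hgen : Subgroup.closure C = ⊤) : Function.Surjective (proj C) := by
  rw [← MonoidHom.range_eq_top, eq_top_iff, ← hgen, Subgroup.closure_le]
  exact fun c hc => ⟨sec C c, proj_sec (subset_wordBall C (by norm_num) hc)⟩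

/-- A defining relation multiplies two products of at most three letters, so words of length `6`
detect it. -/
theorem presentedByWords : PresentedByWords.{w, w'} (sec C '' C) 6 := by
  intro Q _ φ hφ
  have key : ∀ l : List G, (∀ x ∈ l, x ∈ C) → l.length ≤ 6 →
      φ (l.map (sec C)).prod = (l.map (φ ∘ sec C)).prod := by
    intro l hl hlen
    rw [hφ _ (by
      intro x hx
      obtain ⟨y, hy, rfl⟩ := List.mem_map.mp hx
      exact ⟨y, hl y hy, rfl⟩) (by simpa using hlen), List.map_map]
  refine ⟨lift (φ ∘ sec C) fun a b ha hb hab => ?_, ?_⟩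
  · rw [Function.comp_apply, sec_mul ha hb hab]
    obtain ⟨l, hl, hlen, rfl⟩ := ha
    obtain ⟨l', hl', hlen', rfl⟩ := hb
    rw [Function.comp_apply, Function.comp_apply, mulOnWords_sec l hl hlen,
      mulOnWords_sec l' hl' hlen', key l hl (by omega), key l' hl' (by omega), ← List.prod_append,
      ← List.map_append, key _ _ (by simp; omega), List.map_append, List.prod_append]
    intro x hx
    rcases List.mem_append.mp hx with h | h
    exacts [hl x h, hl' x h]
  · rintro _ ⟨c, hc, rfl⟩
    exact lift_sec _ _ (subset_wordBall C (by norm_num) hc)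

variable [TopologicalSpace G] [IsTopologicalGroup G]

/-- The neighbourhoods of the identity of a local cover. -/
noncomputable abbrev filterBasis (hC : C ∈ 𝓝 (1 : G)) (hinv : ∀ x ∈ C, x⁻¹ ∈ C) :
    GroupFilterBasis (LocalCover C) where
  sets := {U | ∃ V ∈ 𝓝 (1 : G), V ⊆ C ∧ sec C '' V = U}
  nonempty := ⟨_, C, hC, subset_rfl, rfl⟩
  inter_sets := by
    rintro _ _ ⟨V, hV, hVC, rfl⟩ ⟨V', hV', -, rfl⟩
    refine ⟨_, ⟨V ∩ V', Filter.inter_mem hV hV', Set.inter_subset_left.trans hVC, rfl⟩, ?_⟩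
    exact Set.image_inter_subset _ _ _
  one' := by
    rintro _ ⟨V, hV, -, rfl⟩
    exact ⟨1, mem_of_mem_nhds hV, sec_one⟩
  mul' := by
    rintro _ ⟨V, hV, hVC, rfl⟩
    have h : ∀ᶠ p : G × G in 𝓝 1 ×ˢ 𝓝 1, p.1 * p.2 ∈ V := by
      have : Filter.Tendsto (fun p : G × G => p.1 * p.2) (𝓝 1 ×ˢ 𝓝 1) (𝓝 1) := by
        simpa [nhds_prod_eq] using (continuous_mul (M := G)).tendsto (1, 1)
      exact this hV
    obtain ⟨U, hU, hUV⟩ := Filter.eventually_prod_self_iff'.mp h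
    refine ⟨_, ⟨U ∩ C, Filter.inter_mem hU hC, Set.inter_subset_right, rfl⟩, ?_⟩
    rintro _ ⟨_, ⟨a, ha, rfl⟩, _, ⟨b, hb, rfl⟩, rfl⟩
    have hab := hUV a ha.1 b hb.1
    have h3 := subset_wordBall C (n := 3) (by norm_num)
    exact ⟨a * b, hab, sec_mul (h3 ha.2) (h3 hb.2) (h3 (hVC hab))⟩
  inv' := by
    rintro _ ⟨V, hV, hVC, rfl⟩
    refine ⟨_, ⟨V⁻¹ ∩ C, Filter.inter_mem (inv_mem_nhds_one G hV) hC, Set.inter_subset_right,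
      rfl⟩, ?_⟩
    rintro _ ⟨a, ha, rfl⟩
    exact ⟨a⁻¹, ha.1, sec_inv hinv (subset_wordBall C (by norm_num) ha.2)⟩
  conj' := by
    let B := {U | ∃ V ∈ 𝓝 (1 : G), V ⊆ C ∧ sec C '' V = U}
    -- The condition is stable under products, so the generators and their inverses suffice.
    let P : LocalCover C → Prop := fun x => ∀ U ∈ B, ∃ V ∈ B, V ⊆ (fun y => x * y * x⁻¹) ⁻¹' U
    have hmul : ∀ x y, P x → P y → P (x * y) := by
      intro x y hx hy U hU
      obtain ⟨V, hV, hVU⟩ := hx U hU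
      obtain ⟨W, hW, hWV⟩ := hy V hV
      refine ⟨W, hW, fun z hz => ?_⟩
      have := hVU (hWV hz)
      simpa [mul_assoc] using this
    have hgen : ∀ c ∈ C, P (sec C c) := by
      rintro c hc _ ⟨V, hV, hVC, rfl⟩
      have hcont : Filter.Tendsto (fun x : G => c * x * c⁻¹) (𝓝 1) (𝓝 1) := by
        have : Continuous fun x : G => c * x * c⁻¹ := by fun_prop
        simpa using this.tendsto 1
      refine ⟨_, ⟨(fun x : G => c * x * c⁻¹) ⁻¹' V ∩ C, Filter.inter_mem (hcont hV) hC,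
        Set.inter_subset_right, rfl⟩, ?_⟩
      rintro _ ⟨x, ⟨hxV, hxC⟩, rfl⟩
      refine ⟨_, hxV, ?_⟩
      -- A conjugate is a word of three letters; this is where radius `3` is needed.
      have := mulOnWords_sec (C := C) [c, x, c⁻¹] (by simp [hc, hxC, hinv c hc]) (by simp)
      simp only [List.prod_cons, List.prod_nil, mul_one, List.map_cons, List.map_nil,
        sec_inv hinv (subset_wordBall C (n := 3) (by norm_num) hc)] at this
      simpa [mul_assoc] using this
    have key : ∀ x : LocalCover C, P x ∧ P x⁻¹ := by
      intro x
      have hx : x ∈ Subgroup.closure (sec C '' C) := by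
        rw [closure_image_sec]
        exact Subgroup.mem_top x
      induction hx using Subgroup.closure_induction with
      | mem x hx =>
        obtain ⟨c, hc, rfl⟩ := hx
        refine ⟨hgen c hc, ?_⟩
        rw [← sec_inv hinv (subset_wordBall C (by norm_num) hc)]
        exact hgen _ (hinv c hc)
      | one => exact ⟨fun U hU => ⟨U, hU, by simp⟩, fun U hU => ⟨U, hU, by simp⟩⟩
      | mul x y _ _ hx hy =>
        refine ⟨hmul _ _ hx.1 hy.1, ?_⟩
        rw [mul_inv_rev]
        exact hmul _ _ hy.2 hx.2
      | inv x _ hx => exact ⟨hx.2, by simpa using hx.1⟩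
    exact fun x U hU => (key x).1 U hU

theorem map_sec_nhds_one (hC : C ∈ 𝓝 (1 : G)) (hinv : ∀ x ∈ C, x⁻¹ ∈ C) :
    @nhds _ (filterBasis hC hinv).topology (1 : LocalCover C) = (𝓝 (1 : G)).map (sec C) := by
  ext U
  rw [(filterBasis hC hinv).nhds_one_hasBasis.mem_iff]
  constructor
  · rintro ⟨_, ⟨V, hV, -, rfl⟩, hVU⟩
    exact Filter.mem_of_superset (Filter.image_mem_map hV) hVU
  · intro hU
    refine ⟨_, ⟨sec C ⁻¹' U ∩ C, Filter.inter_mem hU hC, Set.inter_subset_right, rfl⟩, ?_⟩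
    rintro _ ⟨x, hx, rfl⟩
    exact hx.1

end LocalCover

/-- A compactly generated locally compact group is the quotient of a compactly presented locally
compact group by a discrete normal subgroup. -/
theorem IsCompactlyGeneratedGroup.exists_compactlyPresented_cover [TopologicalSpace G]
    [IsTopologicalGroup G] [LocallyCompactSpace G] [T2Space G]
    (h : IsCompactlyGeneratedGroup G) :
    ∃ (G₀ : Type w) (_ : Group G₀) (_ : TopologicalSpace G₀) (_ : IsTopologicalGroup G₀)
      (_ : LocallyCompactSpace G₀) (_ : T2Space G₀) (π : G₀ →* G),
      IsCompactlyPresentedGroup G₀ ∧ IsOpenQuotientMap π ∧ DiscreteTopology π.ker := by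
  obtain ⟨K, hK, hK1⟩ := exists_compact_mem_nhds (1 : G)
  obtain ⟨C, hCc, hinv, hgen, hKC⟩ := h.exists_symmetric hK
  have hC : C ∈ 𝓝 (1 : G) := Filter.mem_of_superset hK1 hKC
  let B := LocalCover.filterBasis hC hinv
  let _ : TopologicalSpace (LocalCover C) := B.topology
  have : IsTopologicalGroup (LocalCover C) := B.isTopologicalGroup
  have hnhds : 𝓝 (1 : LocalCover C) = (𝓝 (1 : G)).map (LocalCover.sec C) :=
    LocalCover.map_sec_nhds_one hC hinv
  have h3 : C ⊆ wordBall C 3 := subset_wordBall C (by norm_num)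
  have hcont : ContinuousOn (LocalCover.sec C) C := by
    intro a ha
    -- Near `a`, `sec x = sec a * sec (a⁻¹ * x)`, which reduces continuity to the identity.
    have h1 : Filter.Tendsto (fun x => LocalCover.sec C a * LocalCover.sec C (a⁻¹ * x)) (𝓝[C] a)
        (𝓝 (LocalCover.sec C a * 1)) := by
      refine Filter.Tendsto.const_mul _ ?_
      rw [hnhds]
      refine Filter.tendsto_map.comp ?_
      have : Continuous fun x : G => a⁻¹ * x := by fun_prop
      simpa using (this.tendsto a).mono_left nhdsWithin_le_nhds
    rw [mul_one] at h1
    refine h1.congr' ?_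
    filter_upwards [self_mem_nhdsWithin] with x hx
    rw [← LocalCover.sec_mul (h3 ha), mul_inv_cancel_left]
    · exact wordBall_mono_right C (by norm_num) (mul_mem_wordBall
        (subset_wordBall C le_rfl (hinv a ha)) (subset_wordBall C le_rfl hx))
    · rw [mul_inv_cancel_left]
      exact h3 hx
  have hcomp : IsCompact (LocalCover.sec C '' C) := hCc.image_of_continuousOn hcont
  have hmem : LocalCover.sec C '' C ∈ 𝓝 (1 : LocalCover C) := by
    rw [hnhds]
    exact Filter.image_mem_map hC
  have hmap : (𝓝 (1 : LocalCover C)).map (LocalCover.proj C) = 𝓝 1 := by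
    rw [hnhds, Filter.map_map]
    conv_rhs => rw [← Filter.map_id (f := 𝓝 (1 : G))]
    refine Filter.map_congr ?_
    filter_upwards [hC] with x hx
    exact LocalCover.proj_sec (h3 hx)
  have hsep : ∀ x : LocalCover C, x ≠ 1 → ∃ U ∈ 𝓝 (1 : LocalCover C), x ∉ U := by
    intro x hx
    -- Only `c = proj x` can satisfy `sec c = x`. It is removed from the neighbourhood unless it is
    -- `1`, and then `x = sec 1 = 1` is excluded.
    have hne : {c | c = LocalCover.proj C x ∧ c ≠ 1}ᶜ ∈ 𝓝 (1 : G) := by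
      by_cases hp : LocalCover.proj C x = 1
      · exact Filter.mem_of_superset Filter.univ_mem fun c _ hc => hc.2 (hc.1.trans hp)
      · exact Filter.mem_of_superset (isOpen_compl_singleton.mem_nhds (Ne.symm hp))
          fun c hc hc' => hc hc'.1
    refine ⟨LocalCover.sec C '' (C \ {c | c = LocalCover.proj C x ∧ c ≠ 1}), ?_, ?_⟩
    · rw [hnhds]
      exact Filter.image_mem_map (Filter.inter_mem hC hne)
    · rintro ⟨c, ⟨hcC, hc⟩, rfl⟩
      rw [LocalCover.proj_sec (h3 hcC)] at hc
      refine hc ⟨rfl, ?_⟩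
      rintro rfl
      exact hx LocalCover.sec_one
  refine ⟨LocalCover C, inferInstance, inferInstance, inferInstance,
    hcomp.locallyCompactSpace_of_mem_nhds_of_group hmem, IsTopologicalGroup.t2Space_of_one_sep hsep,
    LocalCover.proj C, ?_, ⟨LocalCover.proj_surjective hgen, ?_, ?_⟩, ?_⟩
  · exact LocalCover.presentedByWords.isCompactlyPresentedGroup hcomp LocalCover.closure_image_sec
      (by norm_num)
  · refine continuous_of_continuousAt_one _ ?_
    rw [ContinuousAt, map_one]
    exact hmap.le
  · exact IsTopologicalGroup.isOpenMap_iff_nhds_one.mpr hmap.ge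
  · refine Subgroup.discreteTopology_of_mem_nhds_one _ hmem ?_
    rintro _ ⟨c, hc, rfl⟩ hker
    rw [MonoidHom.mem_ker, LocalCover.proj_sec (h3 hc)] at hker
    rw [hker, LocalCover.sec_one]

end LocalCover

/-! ### Wreathed Coxeter groups as topological groups -/

instance coxeterGroupTopology {V : Type u} (μ : CoxeterMatrix V) : TopologicalSpace μ.Group := ⊥

instance coxeterGroupDiscrete {V : Type u} (μ : CoxeterMatrix V) : DiscreteTopology μ.Group := ⟨rfl⟩

theorem CoxeterMatrix.exists_finite_mem_closure {V : Type u} (μ : CoxeterMatrix V) (w : μ.Group) :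
    ∃ F : Set V, F.Finite ∧ w ∈ Subgroup.closure (μ.simple '' F) := by
  have hw : w ∈ Subgroup.closure (Set.range μ.simple) := by
    rw [μ.closure_range_simple]
    exact Subgroup.mem_top w
  induction hw using Subgroup.closure_induction with
  | mem x hx =>
    obtain ⟨s, rfl⟩ := hx
    exact ⟨{s}, Set.finite_singleton s, Subgroup.subset_closure ⟨s, rfl, rfl⟩⟩
  | one => exact ⟨∅, Set.finite_empty, Subgroup.one_mem _⟩
  | mul x y _ _ hx hy =>
    obtain ⟨F, hF, hx⟩ := hx
    obtain ⟨F', hF', hy⟩ := hy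
    exact ⟨F ∪ F', hF.union hF', Subgroup.mul_mem _
      (Subgroup.closure_mono (Set.image_mono Set.subset_union_left) hx)
      (Subgroup.closure_mono (Set.image_mono Set.subset_union_right) hy)⟩
  | inv x _ hx => exact hx.imp fun F h => ⟨h.1, Subgroup.inv_mem _ h.2⟩

theorem MulAction.exists_eq_smul_out {H : Type*} {V : Type*} [Group H] [MulAction H V] (v : V) :
    ∃ h : H, v = h • (Quotient.mk (MulAction.orbitRel H V) v).out := by
  obtain ⟨h, hh⟩ := (MulAction.orbitRel H V).symm (Quotient.mk_out (s := MulAction.orbitRel H V) v)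
  exact ⟨h, hh.symm⟩

section Wreathed

variable {V : Type u} {H : Type v} [Group H] [MulAction H V] {μ : CoxeterMatrix V}
  {hμ : ∀ (g : H) (s t : V), μ (g • s) (g • t) = μ s t}

theorem coxeterAction_simple (g : H) (s : V) :
    coxeterAction μ hμ g (μ.simple s) = μ.simple (g • s) :=
  coxeterActionHom_simple μ hμ g s

theorem inl_simple_smul (g : H) (s : V) : (inl (μ.simple (g • s)) : WreathedCoxeterGroup μ hμ) =
    inr g * inl (μ.simple s) * inr g⁻¹ := by
  rw [← coxeterAction_simple (hμ := hμ), inl_aut]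

/-- The homomorphism of a wreathed Coxeter group given by an equivariant map on the generators that
satisfies the Coxeter relations. -/
def wreathedLift {Q : Type w} [Group Q] (f : H →* Q) (x : V → Q) (hx : μ.IsLiftable x)
    (hf : ∀ h v, x (h • v) = f h * x v * (f h)⁻¹) : WreathedCoxeterGroup μ hμ →* Q :=
  SemidirectProduct.lift (μ.toCoxeterSystem.lift ⟨x, hx⟩) f fun h => by
    refine μ.toCoxeterSystem.ext_simple fun s => ?_
    have h1 := μ.toCoxeterSystem.lift_apply_simple hx
    rw [CoxeterMatrix.toCoxeterSystem_simple] at h1 ⊢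
    simp [coxeterAction_simple, h1, hf]

theorem wreathedLift_inl_simple {Q : Type w} [Group Q] (f : H →* Q) (x : V → Q)
    (hx : μ.IsLiftable x) (hf : ∀ h v, x (h • v) = f h * x v * (f h)⁻¹) (v : V) :
    wreathedLift (hμ := hμ) f x hx hf (inl (μ.simple v)) = x v := by
  rw [wreathedLift, lift_inl]
  exact μ.toCoxeterSystem.lift_apply_simple hx v

theorem wreathedLift_inr {Q : Type w} [Group Q] (f : H →* Q) (x : V → Q)
    (hx : μ.IsLiftable x) (hf : ∀ h v, x (h • v) = f h * x v * (f h)⁻¹) (h : H) :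
    wreathedLift (hμ := hμ) f x hx hf (inr h) = f h := by
  rw [wreathedLift, lift_inr]

theorem closure_inr_union_inl_simple {S : Set H} (hS : Subgroup.closure S = ⊤) {F : Set V}
    (hF : ∀ v : V, ∃ (h : H), ∃ s ∈ F, v = h • s) :
    Subgroup.closure (inr '' S ∪ (fun v => inl (μ.simple v)) '' F :
      Set (WreathedCoxeterGroup μ hμ)) = ⊤ := by
  rw [eq_top_iff]
  set C := Subgroup.closure (inr '' S ∪ (fun v => inl (μ.simple v)) '' F :
    Set (WreathedCoxeterGroup μ hμ))
  have h1 : ∀ h : H, (inr h : WreathedCoxeterGroup μ hμ) ∈ C := by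
    intro h
    have : Subgroup.closure S ≤ C.comap inr :=
      (Subgroup.closure_le _).mpr fun s hs => Subgroup.subset_closure (Or.inl ⟨s, hs, rfl⟩)
    rw [hS] at this
    exact this (Subgroup.mem_top h)
  have h2 : ∀ w : μ.Group, (inl w : WreathedCoxeterGroup μ hμ) ∈ C := by
    intro w
    have : Subgroup.closure (Set.range μ.simple) ≤ C.comap (inl (φ := coxeterAction μ hμ)) := by
      refine (Subgroup.closure_le _).mpr ?_
      rintro _ ⟨v, rfl⟩
      obtain ⟨h, s, hs, rfl⟩ := hF v
      rw [SetLike.mem_coe, Subgroup.mem_comap, inl_simple_smul]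
      exact C.mul_mem (C.mul_mem (h1 _) (Subgroup.subset_closure (Or.inr ⟨s, hs, rfl⟩))) (h1 _)
    rw [μ.closure_range_simple] at this
    exact this (Subgroup.mem_top w)
  intro x _
  rw [← inl_left_mul_inr_right x]
  exact C.mul_mem (h2 _) (h1 _)

section Topology

variable [TopologicalSpace H]

theorem wreathed_isInducing :
    IsInducing (fun x : WreathedCoxeterGroup μ hμ => (x.left, x.right)) := ⟨rfl⟩

/-- A wreathed Coxeter group is homeomorphic to the product of its factors. -/
def wreathedHomeomorph : WreathedCoxeterGroup μ hμ ≃ₜ μ.Group × H :=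
  equivProd.toHomeomorphOfIsInducing wreathed_isInducing

theorem continuous_wreathed_left : Continuous (fun x : WreathedCoxeterGroup μ hμ => x.left) :=
  continuous_fst.comp wreathed_isInducing.continuous

theorem continuous_rightHom : Continuous (rightHom : WreathedCoxeterGroup μ hμ →* H) :=
  continuous_snd.comp wreathed_isInducing.continuous

theorem continuous_wreathed_inr : Continuous (inr : H →* WreathedCoxeterGroup μ hμ) :=
  wreathed_isInducing.continuous_iff.mpr (continuous_const.prodMk continuous_id)

instance [T2Space H] : T2Space (WreathedCoxeterGroup μ hμ) :=
  (wreathedHomeomorph (μ := μ) (hμ := hμ)).symm.t2Space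

instance [LocallyCompactSpace H] : LocallyCompactSpace (WreathedCoxeterGroup μ hμ) :=
  (wreathedHomeomorph (μ := μ) (hμ := hμ)).isClosedEmbedding.locallyCompactSpace

theorem wreathed_nhds_one : 𝓝 (1 : WreathedCoxeterGroup μ hμ) = (𝓝 (1 : H)).map inr := by
  have h : IsOpenEmbedding (inr : H → WreathedCoxeterGroup μ hμ) := by
    refine .of_continuous_injective_isOpenMap continuous_wreathed_inr inr_injective fun U hU => ?_
    have : inr '' U = (fun x : WreathedCoxeterGroup μ hμ => x.left) ⁻¹' {1} ∩
        rightHom ⁻¹' U := by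
      ext x
      constructor
      · rintro ⟨h, hh, rfl⟩
        exact ⟨rfl, hh⟩
      · rintro ⟨h1, h2⟩
        exact ⟨x.right, h2, SemidirectProduct.ext h1.symm rfl⟩
    rw [this]
    exact ((isOpen_discrete _).preimage continuous_wreathed_left).inter
      (hU.preimage continuous_rightHom)
  rw [h.map_nhds_eq, map_one]

theorem IsCompact.finite_image_left {T : Set (WreathedCoxeterGroup μ hμ)} (hT : IsCompact T) :
    ((fun x : WreathedCoxeterGroup μ hμ => x.left) '' T).Finite :=
  (hT.image continuous_wreathed_left).finite_of_discrete

/-- An element of `W` involves finitely many generators, and their common stabilizer is open and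
fixes it. -/
theorem isOpen_stabilizer_coxeterAction [IsTopologicalGroup H]
    (hopen : ∀ v : V, IsOpen (MulAction.stabilizer H v : Set H)) (w : μ.Group) :
    IsOpen {h : H | coxeterAction μ hμ h w = w} := by
  obtain ⟨F, hF, hw⟩ := μ.exists_finite_mem_closure w
  let L : Subgroup H :=
    { carrier := {h | coxeterAction μ hμ h w = w}
      mul_mem' := fun {a b} ha hb => by
        rw [Set.mem_ofPred_eq] at ha hb ⊢
        rw [map_mul, MulAut.mul_apply, hb, ha]
      one_mem' := by simp
      inv_mem' := fun {a} ha => by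
        rw [Set.mem_ofPred_eq] at ha ⊢
        rw [map_inv, MulAut.inv_apply, MulEquiv.symm_apply_eq, ha] }
  change IsOpen (L : Set H)
  refine L.isOpen_of_mem_nhds (g := 1) ?_
  have h1 : ⋂ v ∈ F, (MulAction.stabilizer H v : Set H) ∈ 𝓝 (1 : H) :=
    (Filter.biInter_mem hF).mpr fun v _ => (hopen v).mem_nhds (Subgroup.one_mem _)
  refine Filter.mem_of_superset h1 fun h hh => ?_
  have hle : Subgroup.closure (μ.simple '' F) ≤
      MonoidHom.eqLocus (coxeterAction μ hμ h).toMonoidHom (MonoidHom.id _) := by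
    refine (Subgroup.closure_le _).mpr ?_
    rintro _ ⟨v, hv, rfl⟩
    have : h • v = v := Set.mem_iInter₂.mp hh v hv
    change coxeterAction μ hμ h (μ.simple v) = μ.simple v
    rw [coxeterAction_simple, this]
  exact hle hw

theorem wreathed_isTopologicalGroup [IsTopologicalGroup H]
    (hopen : ∀ v : V, IsOpen (MulAction.stabilizer H v : Set H)) :
    IsTopologicalGroup (WreathedCoxeterGroup μ hμ) := by
  let _ : MulAction H μ.Group := MulAction.compHom μ.Group (coxeterAction μ hμ)
  have hsmul : ∀ (h : H) (w : μ.Group), h • w = coxeterAction μ hμ h w := fun _ _ => rfl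
  have hcont : ContinuousSMul H μ.Group :=
    continuousSMul_iff_stabilizer_isOpen.mpr fun w => isOpen_stabilizer_coxeterAction hopen w
  have hl := continuous_wreathed_left (μ := μ) (hμ := hμ)
  have hr := continuous_rightHom (μ := μ) (hμ := hμ)
  refine { continuous_mul := ?_, continuous_inv := ?_ }
  · refine wreathed_isInducing.continuous_iff.mpr (Continuous.prodMk ?_ ?_)
    · have : Continuous fun p : WreathedCoxeterGroup μ hμ × WreathedCoxeterGroup μ hμ =>
          p.1.left * rightHom p.1 • p.2.left :=
        (hl.comp continuous_fst).mul ((hr.comp continuous_fst).smul (hl.comp continuous_snd))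
      exact this
    · have : Continuous fun p : WreathedCoxeterGroup μ hμ × WreathedCoxeterGroup μ hμ =>
          rightHom p.1 * rightHom p.2 :=
        (hr.comp continuous_fst).mul (hr.comp continuous_snd)
      exact this
  · refine wreathed_isInducing.continuous_iff.mpr (Continuous.prodMk ?_ ?_)
    · have : Continuous fun x : WreathedCoxeterGroup μ hμ => (rightHom x)⁻¹ • x.left⁻¹ :=
        hr.inv.smul hl.inv
      exact this
    · have : Continuous fun x : WreathedCoxeterGroup μ hμ => (rightHom x)⁻¹ := hr.inv
      exact this

theorem wreathed_isCompactlyGeneratedGroup [Finite (MulAction.orbitRel.Quotient H V)]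
    (h : IsCompactlyGeneratedGroup H) :
    IsCompactlyGeneratedGroup (WreathedCoxeterGroup μ hμ) := by
  obtain ⟨S, hS, hgen⟩ := h
  refine ⟨_, (hS.image continuous_wreathed_inr).union ((Set.finite_range
    (Quotient.out : MulAction.orbitRel.Quotient H V → V)).image _).isCompact,
    closure_inr_union_inl_simple hgen fun v => ?_⟩
  obtain ⟨h, hh⟩ := MulAction.exists_eq_smul_out (H := H) v
  exact ⟨h, _, ⟨_, rfl⟩, hh⟩

/-- The left components of a compact generating set are finite in number and involve finitely many
generators. The subgroup of `W` generated by the orbits of these is `H`-stable, so its product with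
`H` is everything; hence these orbits exhaust `V`. -/
theorem IsCompactlyGeneratedGroup.of_wreathed
    (h : IsCompactlyGeneratedGroup (WreathedCoxeterGroup μ hμ)) :
    Finite (MulAction.orbitRel.Quotient H V) ∧ IsCompactlyGeneratedGroup H := by
  obtain ⟨T, hT, hgen⟩ := h
  constructor
  · choose F hF hmem using μ.exists_finite_mem_closure
    set F' : Set V := ⋃ w ∈ (fun x : WreathedCoxeterGroup μ hμ => x.left) '' T, F w
    have hF' : F'.Finite := hT.finite_image_left.biUnion fun w _ => hF w
    set A : Set V := {v | ∃ (h : H), ∃ s ∈ F', v = h • s}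
    set P := Subgroup.closure (μ.simple '' A)
    have hP : ∀ (h : H), ∀ w ∈ P, coxeterAction μ hμ h w ∈ P := by
      intro h
      have : P ≤ P.comap (coxeterAction μ hμ h).toMonoidHom := by
        refine (Subgroup.closure_le _).mpr ?_
        rintro _ ⟨v, ⟨g, s, hs, rfl⟩, rfl⟩
        change coxeterAction μ hμ h (μ.simple (g • s)) ∈ P
        rw [coxeterAction_simple]
        exact Subgroup.subset_closure ⟨_, ⟨h * g, s, hs, (mul_smul h g s).symm⟩, rfl⟩
      exact this
    let B : Subgroup (WreathedCoxeterGroup μ hμ) :=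
      { carrier := {x | x.left ∈ P}
        mul_mem' := fun {a b} ha hb => P.mul_mem ha (hP _ _ hb)
        one_mem' := P.one_mem
        inv_mem' := fun {a} ha => hP _ _ (P.inv_mem ha) }
    have hB : B = ⊤ := by
      rw [eq_top_iff, ← hgen, Subgroup.closure_le]
      intro x hx
      refine Subgroup.closure_mono (Set.image_mono ?_) (hmem x.left)
      intro s hs
      exact ⟨1, s, Set.mem_biUnion ⟨x, hx, rfl⟩ hs, (one_smul H s).symm⟩
    have hA : ∀ v, v ∈ A := by
      intro v
      have : (inl (μ.simple v) : WreathedCoxeterGroup μ hμ) ∈ B := hB ▸ Subgroup.mem_top _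
      exact μ.mem_of_simple_mem_closure this
    have : (Quotient.mk (MulAction.orbitRel H V) '' F') = Set.univ := by
      refine Set.eq_univ_of_forall fun q => ?_
      induction q using Quotient.inductionOn with
      | h v =>
        obtain ⟨h, s, hs, rfl⟩ := hA v
        exact ⟨s, hs, Quotient.sound ((MulAction.orbitRel H V).symm ⟨h, rfl⟩)⟩
    exact Set.finite_univ_iff.mp (this ▸ hF'.image _)
  · refine ⟨_, hT.image continuous_rightHom, ?_⟩
    rw [← MonoidHom.map_closure, hgen, ← MonoidHom.range_eq_map, MonoidHom.range_eq_top]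
    exact rightHom_surjective

end Topology

/-! ### Functoriality in the set of generators -/

section Map

variable {X : Type u} {Y : Type w} [MulAction H X] [MulAction H Y] {μX : CoxeterMatrix X}
  {μY : CoxeterMatrix Y} {hX : ∀ (g : H) (s t : X), μX (g • s) (g • t) = μX s t}
  {hY : ∀ (g : H) (s t : Y), μY (g • s) (g • t) = μY s t}

/-- The homomorphism of wreathed Coxeter groups induced by an equivariant map of generators under
which the Coxeter relations hold. -/
def wreathedMap (q : X → Y) (hq : ∀ (h : H) x, q (h • x) = h • q x)
    (hdvd : ∀ x x', μY (q x) (q x') ∣ μX x x') :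
    WreathedCoxeterGroup μX hX →* WreathedCoxeterGroup μY hY :=
  wreathedLift inr (fun x => inl (μY.simple (q x)))
    (fun x x' => by
      obtain ⟨k, hk⟩ := hdvd x x'
      rw [hk, ← map_mul, pow_mul, ← map_pow, μY.simple_mul_simple_pow, map_one, one_pow])
    (fun h x => by rw [hq, inl_simple_smul, map_inv])

variable {q : X → Y} {hq : ∀ (h : H) x, q (h • x) = h • q x}
  {hdvd : ∀ x x', μY (q x) (q x') ∣ μX x x'}

theorem wreathedMap_inl_simple (x : X) :
    wreathedMap (hX := hX) (hY := hY) q hq hdvd (inl (μX.simple x)) = inl (μY.simple (q x)) :=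
  wreathedLift_inl_simple _ _ _ _ x

theorem wreathedMap_inr (h : H) : wreathedMap (hX := hX) (hY := hY) q hq hdvd (inr h) = inr h :=
  wreathedLift_inr _ _ _ _ h

theorem wreathedMap_relation_mem_ker (x x' : X) :
    (inl (μX.simple x * μX.simple x') : WreathedCoxeterGroup μX hX) ^ μY (q x) (q x') ∈
      (wreathedMap (hX := hX) (hY := hY) q hq hdvd).ker := by
  rw [MonoidHom.mem_ker, map_pow, map_mul, map_mul, wreathedMap_inl_simple,
    wreathedMap_inl_simple, ← map_mul, ← map_pow, μY.simple_mul_simple_pow, map_one]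

theorem wreathedMap_surjective (hsurj : Function.Surjective q) :
    Function.Surjective (wreathedMap (hX := hX) (hY := hY) q hq hdvd) := by
  rw [← MonoidHom.range_eq_top, eq_top_iff, ← closure_inr_union_inl_simple
    (Subgroup.closure_univ (G := H)) (F := Set.univ) fun v => ⟨1, v, trivial, by simp⟩,
    Subgroup.closure_le]
  rintro _ (⟨h, -, rfl⟩ | ⟨y, -, rfl⟩)
  · exact ⟨inr h, wreathedMap_inr h⟩
  · obtain ⟨x, rfl⟩ := hsurj y
    exact ⟨_, wreathedMap_inl_simple x⟩

/-- Modulo `N`, the generators satisfy the relations of the target. The diagonal case `μY = 1` makes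
the image of `x` depend only on `q x`, so a section of `q` yields a homomorphism back to the
quotient by `N`. -/
theorem wreathedMap_ker_le (hsurj : Function.Surjective q)
    (N : Subgroup (WreathedCoxeterGroup μX hX)) [N.Normal]
    (hN : ∀ x x', (inl (μX.simple x * μX.simple x') : WreathedCoxeterGroup μX hX) ^
      μY (q x) (q x') ∈ N) :
    (wreathedMap (hX := hX) (hY := hY) q hq hdvd).ker ≤ N := by
  choose σ hσ using hsurj
  let p := QuotientGroup.mk' N
  have hp : ∀ x x', q x = q x' → p (inl (μX.simple x)) = p (inl (μX.simple x')) := by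
    intro x x' hxx'
    have := (QuotientGroup.eq_one_iff (N := N) _).mpr (hN x x')
    rw [hxx', μY.diagonal, pow_one, map_mul] at this
    have h2 : p (inl (μX.simple x)) * p (inl (μX.simple x')) = 1 := by
      rw [← map_mul]
      exact this
    rw [eq_inv_of_mul_eq_one_left h2, ← map_inv, ← map_inv, μX.simple_inv]
  let ψ : WreathedCoxeterGroup μY hY →* WreathedCoxeterGroup μX hX ⧸ N :=
    wreathedLift (p.comp inr) (fun y => p (inl (μX.simple (σ y))))
      (fun y y' => by
        have := (QuotientGroup.eq_one_iff (N := N) _).mpr (hN (σ y) (σ y'))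
        rw [hσ, hσ] at this
        rw [← map_mul, ← map_mul, ← map_pow]
        exact this)
      (fun h y => by
        rw [MonoidHom.comp_apply, ← map_inv, ← map_mul, ← map_mul, ← map_inv, ← inl_simple_smul]
        exact hp _ _ (by rw [hσ, hq, hσ]))
  have hψ : ψ.comp (wreathedMap q hq hdvd) = p := by
    refine MonoidHom.eq_of_eqOn_dense (closure_inr_union_inl_simple
      (Subgroup.closure_univ (G := H)) (F := Set.univ) fun v => ⟨1, v, trivial, by simp⟩) ?_
    rintro _ (⟨h, -, rfl⟩ | ⟨x, -, rfl⟩)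
    · rw [MonoidHom.comp_apply, wreathedMap_inr]
      exact wreathedLift_inr _ _ _ _ h
    · change ψ (wreathedMap q hq hdvd (inl (μX.simple x))) = p (inl (μX.simple x))
      rw [wreathedMap_inl_simple]
      exact (wreathedLift_inl_simple _ _ _ _ (q x)).trans (hp _ _ (hσ _))
  intro x hx
  refine (QuotientGroup.eq_one_iff x).mp ?_
  change p x = 1
  rw [← hψ, MonoidHom.comp_apply, MonoidHom.mem_ker.mp hx, map_one]

variable [TopologicalSpace H] [IsTopologicalGroup H]

theorem wreathedMap_isOpenQuotientMap (hoX : ∀ v : X, IsOpen (MulAction.stabilizer H v : Set H))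
    (hoY : ∀ v : Y, IsOpen (MulAction.stabilizer H v : Set H)) (hsurj : Function.Surjective q) :
    IsOpenQuotientMap (wreathedMap (hX := hX) (hY := hY) q hq hdvd) := by
  have := wreathed_isTopologicalGroup (μ := μX) (hμ := hX) hoX
  have := wreathed_isTopologicalGroup (μ := μY) (hμ := hY) hoY
  have hmap : (𝓝 1).map (wreathedMap (hX := hX) (hY := hY) q hq hdvd) = 𝓝 1 := by
    rw [wreathed_nhds_one, wreathed_nhds_one, Filter.map_map]
    exact Filter.map_congr (Filter.Eventually.of_forall fun h => wreathedMap_inr h)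
  refine ⟨wreathedMap_surjective hsurj, continuous_of_continuousAt_one _ ?_,
    IsTopologicalGroup.isOpenMap_iff_nhds_one.mpr hmap.ge⟩
  rw [ContinuousAt, map_one]
  exact hmap.le

/-- The copy of `H` is an open subgroup on which the map is injective. -/
theorem wreathedMap_discreteTopology_ker
    (hoX : ∀ v : X, IsOpen (MulAction.stabilizer H v : Set H)) :
    DiscreteTopology (wreathedMap (hX := hX) (hY := hY) q hq hdvd).ker := by
  have := wreathed_isTopologicalGroup (μ := μX) (hμ := hX) hoX
  refine Subgroup.discreteTopology_of_mem_nhds_one _ (U := Set.range inr) ?_ ?_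
  · rw [wreathed_nhds_one]
    exact Filter.range_mem_map
  · rintro _ ⟨h, rfl⟩ hh
    rw [MonoidHom.mem_ker, wreathedMap_inr] at hh
    rw [inr_injective (hh.trans (map_one inr).symm), map_one]

end Map

end Wreathed

/-! ### Sufficiency of the three conditions -/

section Presentation

variable {V : Type u} {H : Type v} [Group H] [MulAction H V] {μ : CoxeterMatrix V}
  {hμ : ∀ (g : H) (s t : V), μ (g • s) (g • t) = μ s t}

theorem Set.Finite.exists_finite_subset_image_eq {α β : Type*} {f : α → β} {A : Set α}
    (h : (f '' A).Finite) : ∃ B ⊆ A, B.Finite ∧ f '' B = f '' A := by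
  have := h.to_subtype
  choose σ hσ hfσ using fun b : f '' A => b.2
  refine ⟨Set.range σ, Set.range_subset_iff.mpr hσ, Set.finite_range σ, ?_⟩
  rw [← Set.range_comp, show f ∘ σ = Subtype.val from funext hfσ, Subtype.range_coe]

theorem MulOnWords.map_prod_pow {G : Type w} {Q : Type w'} [Group G] [Group Q] {S : Set G} {n : ℕ}
    {φ : G → Q} (h : MulOnWords S n φ) {l : List G} (hl : ∀ x ∈ l, x ∈ S) {k : ℕ}
    (hk : k * l.length ≤ n) : φ (l.prod ^ k) = (l.map φ).prod ^ k := by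
  have := h (List.replicate k l).flatten (by
    intro x hx
    obtain ⟨l', hl', hx⟩ := List.mem_flatten.mp hx
    rw [List.eq_of_mem_replicate hl'] at hx
    exact hl x hx) (by simpa using hk)
  simpa [List.prod_flatten, List.map_flatten, List.map_replicate, List.prod_replicate] using this

variable [TopologicalSpace H] [IsTopologicalGroup H] [LocallyCompactSpace H] [T2Space H]

theorem wreathed_isCompactlyPresentedGroup [Finite (MulAction.orbitRel.Quotient H V)]
    (hstab : ∀ v : V, IsCompactlyGeneratedGroup (MulAction.stabilizer H v))
    (hH : IsCompactlyPresentedGroup H)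
    (hP : (MulAction.orbit H '' {p : V × V | μ p.1 p.2 ≠ 0}).Finite) :
    IsCompactlyPresentedGroup (WreathedCoxeterGroup μ hμ) := by
  let ρ : V → V := fun v => (Quotient.mk (MulAction.orbitRel H V) v).out
  have hρsmul : ∀ (h : H) v, ρ (h • v) = ρ v := fun h v =>
    congrArg Quotient.out (Quotient.sound (s := MulAction.orbitRel H V) ⟨h, rfl⟩)
  have hρρ : ∀ v, ρ (ρ v) = ρ v := fun v => congrArg Quotient.out (Quotient.out_eq _)
  have hρfin : (Set.range ρ).Finite :=
    (Set.finite_range (Quotient.out : MulAction.orbitRel.Quotient H V → V)).subset (by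
      rintro _ ⟨v, rfl⟩
      exact ⟨_, rfl⟩)
  choose τ hτ using fun v : V => MulAction.exists_eq_smul_out (H := H) v
  replace hτ : ∀ v, v = τ v • ρ v := hτ
  choose K hKc hKgen using hstab
  -- One pair is chosen from each orbit; since `μ` is constant on orbits, its finite entries are
  -- bounded by some `M`.
  obtain ⟨P, hPsub, hPfin, hPim⟩ := hP.exists_finite_subset_image_eq
  obtain ⟨M, hM⟩ : ∃ M, ∀ p ∈ P, μ p.1 p.2 ≤ M := by
    obtain ⟨M, hM⟩ := (hPfin.image fun p => μ p.1 p.2).bddAbove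
    exact ⟨M, fun p hp => hM ⟨p, hp, rfl⟩⟩
  obtain ⟨S, n, hSc, hS, hSgen, hsub, hpres⟩ := hH.exists_presentedByWords.{v, max u v}
    (K := (⋃ r ∈ Set.range ρ, Subtype.val '' K r) ∪
      ((fun p : V × V => τ p.1) '' P ∪ (fun p : V × V => τ p.2) '' P))
    ((hρfin.isCompact_biUnion fun r _ => (hKc r).image continuous_subtype_val).union
      ((hPfin.image _).union (hPfin.image _)).isCompact)
  let w : V → WreathedCoxeterGroup μ hμ := fun v => inl (μ.simple v)
  set T : Set (WreathedCoxeterGroup μ hμ) := inr '' S ∪ w '' Set.range ρ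
  have hTS : ∀ h ∈ S, inr h ∈ T := fun h hh => Or.inl ⟨h, hh, rfl⟩
  have hTw : ∀ v, w (ρ v) ∈ T := fun v => Or.inr ⟨_, ⟨v, rfl⟩, rfl⟩
  -- Length `n` serves the relations of `H`, and length `2` the commutation with stabilizers.
  -- Writing `w_v` as `τ w_r τ⁻¹` makes `w_s w_t` a word of six letters, so a Coxeter relation has
  -- length at most `6 M`.
  refine PresentedByWords.isCompactlyPresentedGroup (S := T) (n := n + M * 6 + 2)
    ((hSc.image continuous_wreathed_inr).union (hρfin.image _).isCompact)
    (closure_inr_union_inl_simple hSgen fun v => ⟨τ v, ρ v, ⟨v, rfl⟩, hτ v⟩) (by omega)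
    fun Q _ φ hφ => ?_
  obtain ⟨f, hf⟩ := hpres Q (φ ∘ inr) (fun l hl hlen => by
    have := hφ (l.map inr) (by
      intro x hx
      obtain ⟨y, hy, rfl⟩ := List.mem_map.mp hx
      exact hTS y (hl y hy)) (by rw [List.length_map]; omega)
    simpa [map_list_prod] using this)
  replace hf : ∀ s ∈ S, f s = φ (inr s) := hf
  have hcomm : ∀ v, ∀ h ∈ MulAction.stabilizer H (ρ v), f h * φ (w (ρ v)) = φ (w (ρ v)) * f h := by
    intro v
    set L := (Subgroup.centralizer {φ (w (ρ v))}).comap f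
    have hmem : ∀ h, h ∈ L ↔ f h * φ (w (ρ v)) = φ (w (ρ v)) * f h := by
      intro h
      rw [Subgroup.mem_comap, Subgroup.mem_centralizer_singleton_iff]
    have hle : Subgroup.closure (K (ρ v)) ≤
        L.comap (MulAction.stabilizer H (ρ v)).subtype := by
      refine (Subgroup.closure_le _).mpr fun k hk => ?_
      have hkS : (k : H) ∈ S :=
        hsub (Or.inl (Set.mem_biUnion (⟨v, rfl⟩ : ρ v ∈ Set.range ρ) ⟨k, hk, rfl⟩))
      refine (hmem k).mpr ?_
      have h1 := hφ [inr (k : H), w (ρ v)] (by simp [hTS _ hkS, hTw]) (by simp)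
      have h2 := hφ [w (ρ v), inr (k : H)] (by simp [hTS _ hkS, hTw]) (by simp)
      simp only [List.prod_cons, List.prod_nil, mul_one, List.map_cons, List.map_nil] at h1 h2
      have h3 : inr (k : H) * w (ρ v) = w (ρ v) * inr (k : H) := by
        have := inl_simple_smul (hμ := hμ) (k : H) (ρ v)
        rw [MulAction.mem_stabilizer_iff.mp k.2, map_inv] at this
        exact (eq_mul_inv_iff_mul_eq.mp this).symm
      rw [hf _ hkS, ← h1, ← h2, h3]
    intro h hh
    rw [hKgen] at hle
    exact (hmem h).mp (hle (Subgroup.mem_top ⟨h, hh⟩))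
  let x : V → Q := fun v => f (τ v) * φ (w (ρ v)) * (f (τ v))⁻¹
  -- By the commutation relations, the conjugate does not depend on the element that carries `ρ v`
  -- to the given point.
  have hx : ∀ v a b, a • ρ v = b • ρ v →
      f a * φ (w (ρ v)) * (f a)⁻¹ = f b * φ (w (ρ v)) * (f b)⁻¹ := by
    intro v a b hab
    have h1 := hcomm v (b⁻¹ * a) (by
      rw [MulAction.mem_stabilizer_iff, mul_smul, hab, inv_smul_smul])
    have h2 : f a = f b * f (b⁻¹ * a) := by rw [← map_mul, mul_inv_cancel_left]
    calc f a * φ (w (ρ v)) * (f a)⁻¹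
        = f b * (f (b⁻¹ * a) * φ (w (ρ v)) * (f (b⁻¹ * a))⁻¹) * (f b)⁻¹ := by rw [h2]; group
      _ = f b * φ (w (ρ v)) * (f b)⁻¹ := by rw [mul_inv_eq_of_eq_mul h1]
  have hequiv : ∀ (h : H) v, x (h • v) = f h * x v * (f h)⁻¹ := by
    intro h v
    have h1 := hx v (τ (h • v)) (h * τ v) (by
      rw [mul_smul, ← hτ v]
      conv_rhs => rw [hτ (h • v), hρsmul])
    change f (τ (h • v)) * φ (w (ρ (h • v))) * (f (τ (h • v)))⁻¹ = _
    rw [hρsmul, h1]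
    simp only [x, map_mul, mul_inv_rev, mul_assoc]
  have hlift : μ.IsLiftable x := by
    intro s t
    by_cases hst : μ s t = 0
    · rw [hst, pow_zero]
    -- Equivariance moves the relation to the chosen pair of the orbit, whose transporters lie in
    -- `S`.
    obtain ⟨p, hp, hpo⟩ : MulAction.orbit H (s, t) ∈ MulAction.orbit H '' P := by
      rw [hPim]
      exact ⟨(s, t), hst, rfl⟩
    obtain ⟨h, hh⟩ := MulAction.orbit_eq_iff.mp hpo.symm
    obtain ⟨rfl, rfl⟩ := Prod.ext_iff.mp hh
    have hp1 : τ p.1 ∈ S := hsub (Or.inr (Or.inl ⟨p, hp, rfl⟩))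
    have hp2 : τ p.2 ∈ S := hsub (Or.inr (Or.inr ⟨p, hp, rfl⟩))
    have key : (x p.1 * x p.2) ^ μ p.1 p.2 = 1 := by
      have h1 := hφ.map_prod_pow (k := μ p.1 p.2) (l := [inr (τ p.1), w (ρ p.1), inr (τ p.1)⁻¹,
        inr (τ p.2), w (ρ p.2), inr (τ p.2)⁻¹])
        (by simp [hTS _ hp1, hTS _ hp2, hTw, hTS _ (hS _ hp1), hTS _ (hS _ hp2), -map_inv])
        (by
          have := hM p hp
          simp only [List.length_cons, List.length_nil]
          omega)
      have h2 : ∀ v, inr (τ v) * w (ρ v) * inr (τ v)⁻¹ = w v := by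
        intro v
        conv_rhs => rw [hτ v]
        exact (inl_simple_smul (hμ := hμ) (τ v) (ρ v)).symm
      simp only [List.prod_cons, List.prod_nil, mul_one, List.map_cons, List.map_nil, ← mul_assoc,
        h2] at h1
      rw [← hf _ hp1, ← hf _ hp2, ← hf _ (hS _ hp1),
        ← hf _ (hS _ hp2), map_inv, map_inv, ← map_mul, ← map_pow, μ.simple_mul_simple_pow,
        map_one, hφ.map_one] at h1
      rw [h1]
      simp only [x, mul_assoc]
    change (x (h • p.1) * x (h • p.2)) ^ μ (h • p.1) (h • p.2) = 1
    rw [hequiv, hequiv, hμ]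
    have h3 : f h * x p.1 * (f h)⁻¹ * (f h * x p.2 * (f h)⁻¹) =
        f h * (x p.1 * x p.2) * (f h)⁻¹ := by group
    rw [h3, conj_pow, key]
    group
  refine ⟨wreathedLift f x hlift hequiv, ?_⟩
  rintro _ (⟨s, hs, rfl⟩ | ⟨_, ⟨v, rfl⟩, rfl⟩)
  · rw [wreathedLift_inr, hf s hs]
  · refine (wreathedLift_inl_simple _ _ _ _ (ρ v)).trans ?_
    have := hx v (τ (ρ v)) 1 (by
      rw [one_smul]
      conv_rhs => rw [hτ (ρ v), hρρ])
    simp only [x, hρρ, this, map_one, one_mul, inv_one, mul_one]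

end Presentation

/-! ### Necessity: compact generation of the stabilizers -/

section Stabilizers

theorem IsCompactlyGeneratedGroup.of_subgroup_closure {H : Type v} [Group H] [TopologicalSpace H]
    {L : Subgroup H} {K : Set H} (hK : IsCompact K) (h : Subgroup.closure K = L) :
    IsCompactlyGeneratedGroup L := by
  subst h
  refine ⟨Subtype.val ⁻¹' K, ?_, Subgroup.closure_closure_coe_preimage⟩
  rw [Subtype.isCompact_iff]
  convert hK
  refine Set.image_preimage_eq_of_subset ?_
  rw [Subtype.range_coe]
  exact Subgroup.subset_closure

/-- The Coxeter matrix pulled back along a map, with entry `∞` within the fibres. -/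
noncomputable def CoxeterMatrix.pullback {X : Type*} {V : Type*} (μ : CoxeterMatrix V) (q : X → V) :
    CoxeterMatrix X := by
  classical exact
  { M := fun x y => if x = y then 1 else if q x = q y then 0 else μ (q x) (q y)
    isSymm := by
      refine Matrix.IsSymm.ext fun x y => ?_
      simp only [eq_comm (a := y), eq_comm (a := q y), μ.symmetric (q y)]
    diagonal := by simp
    off_diagonal := fun x y hxy => by
      rw [if_neg hxy]
      split_ifs with h
      · simp
      · exact μ.off_diagonal _ _ h }

section Pullback

variable {X : Type*} {V : Type*} (μ : CoxeterMatrix V) (q : X → V)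

theorem CoxeterMatrix.pullback_of_eq {x y : X} (hxy : x ≠ y) (h : q x = q y) :
    μ.pullback q x y = 0 := by
  simp [pullback, hxy, h]

theorem CoxeterMatrix.pullback_of_ne {x y : X} (h : q x ≠ q y) :
    μ.pullback q x y = μ (q x) (q y) := by
  have hxy : x ≠ y := fun e => h (congrArg q e)
  simp [pullback, hxy, h]

/-- With `∞` coded as `0`, divisibility says exactly that the Coxeter relations of the pullback hold
below. -/
theorem CoxeterMatrix.dvd_pullback (x y : X) : μ (q x) (q y) ∣ μ.pullback q x y := by
  rcases eq_or_ne x y with rfl | hxy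
  · simp
  rcases eq_or_ne (q x) (q y) with h | h
  · rw [μ.pullback_of_eq q hxy h]
    exact dvd_zero _
  · rw [μ.pullback_of_ne q h]

theorem CoxeterMatrix.pullback_dvd_pullback {X' : Type*} (q' : X' → V) {r : X → X'}
    (hr : ∀ x, q' (r x) = q x) (x y : X) : μ.pullback q' (r x) (r y) ∣ μ.pullback q x y := by
  rcases eq_or_ne x y with rfl | hxy
  · simp
  rcases eq_or_ne (q x) (q y) with h | h
  · rw [μ.pullback_of_eq q hxy h]
    exact dvd_zero _
  · rw [μ.pullback_of_ne q h, μ.pullback_of_ne q' (by rwa [hr, hr]), hr, hr]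

theorem CoxeterMatrix.pullback_smul {H : Type*} [Group H] [MulAction H X] [MulAction H V]
    (hμ : ∀ (g : H) (s t : V), μ (g • s) (g • t) = μ s t) (hq : ∀ (h : H) x, q (h • x) = h • q x)
    (g : H) (x y : X) : μ.pullback q (g • x) (g • y) = μ.pullback q x y := by
  rcases eq_or_ne x y with rfl | hxy
  · simp
  have hxy' : g • x ≠ g • y := fun e => hxy (MulAction.injective g e)
  rcases eq_or_ne (q x) (q y) with h | h
  · rw [μ.pullback_of_eq q hxy h, μ.pullback_of_eq q hxy' (by rw [hq, hq, h])]
  · rw [μ.pullback_of_ne q h, μ.pullback_of_ne q (by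
      rw [hq, hq]
      exact fun e => h (MulAction.injective g e)), hq, hq, hμ]

end Pullback

variable {V : Type u} {H : Type v} [Group H] [MulAction H V]

/-- The complement of an orbit. -/
def orbitCompl (H : Type v) [Group H] [MulAction H V] (v : V) : SubMulAction H V where
  carrier := (MulAction.orbit H v)ᶜ
  smul_mem' h x hx := by
    rintro ⟨g, hg⟩
    refine hx ⟨h⁻¹ * g, ?_⟩
    rw [← inv_smul_smul h x, ← hg]
    exact mul_smul h⁻¹ g v

/-- The `H`-set obtained by replacing the orbit of `v` by the coset space of a subgroup `M`. -/
abbrev SplitOrbit (v : V) (M : Subgroup H) : Type (max u v) := orbitCompl H v ⊕ (H ⧸ M)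

namespace SplitOrbit

variable {v : V} {M : Subgroup H}

/-- The projection to the original `H`-set, for a subgroup of the stabilizer. -/
def proj (hM : M ≤ MulAction.stabilizer H v) : SplitOrbit v M → V :=
  Sum.elim Subtype.val
    (MulAction.ofQuotientStabilizer H v ∘ Subgroup.quotientMapOfLE hM)

variable (hM : M ≤ MulAction.stabilizer H v)

theorem proj_inr (g : H) : proj hM (Sum.inr (g : H ⧸ M)) = g • v := rfl

theorem smul_inr (h g : H) :
    h • (Sum.inr (g : H ⧸ M) : SplitOrbit v M) = Sum.inr ((h * g : H) : H ⧸ M) := rfl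

theorem proj_smul (h : H) (x : SplitOrbit v M) : proj hM (h • x) = h • proj hM x := by
  obtain ⟨x, hx⟩ | x := x
  · rfl
  · induction x using QuotientGroup.induction_on with
    | H g => rw [smul_inr, proj_inr, proj_inr, mul_smul]

theorem proj_surjective : Function.Surjective (proj hM) := by
  intro w
  by_cases hw : w ∈ MulAction.orbit H v
  · obtain ⟨g, rfl⟩ := hw
    exact ⟨Sum.inr (g : H ⧸ M), rfl⟩
  · exact ⟨Sum.inl ⟨w, hw⟩, rfl⟩

/-- Every coincidence within a fibre is thus a translate of one between the base coset and `lM`, so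
the kernel needs only relators indexed by the stabilizer. -/
theorem eq_or_of_proj_eq {x y : SplitOrbit v M} (h : proj hM x = proj hM y) :
    x = y ∨ ∃ g l : H, l ∈ MulAction.stabilizer H v ∧ x = g • Sum.inr ((1 : H) : H ⧸ M) ∧
      y = g • Sum.inr (l : H ⧸ M) := by
  obtain ⟨x, hx⟩ | x := x <;> obtain ⟨y, hy⟩ | y := y
  · exact Or.inl (congrArg Sum.inl (Subtype.ext h))
  · induction y using QuotientGroup.induction_on with
    | H g => exact absurd ⟨g, h.symm⟩ hx
  · induction x using QuotientGroup.induction_on with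
    | H g => exact absurd ⟨g, h⟩ hy
  · induction x using QuotientGroup.induction_on with
    | H g =>
      induction y using QuotientGroup.induction_on with
      | H g' =>
        rw [proj_inr, proj_inr] at h
        refine Or.inr ⟨g, g⁻¹ * g', ?_, ?_, ?_⟩
        · rw [MulAction.mem_stabilizer_iff, mul_smul, ← h, inv_smul_smul]
        · rw [smul_inr, mul_one]
        · rw [smul_inr, mul_inv_cancel_left]

theorem finite_orbits [Finite (MulAction.orbitRel.Quotient H V)]
    (hM : M ≤ MulAction.stabilizer H v) :
    Finite (MulAction.orbitRel.Quotient H (SplitOrbit v M)) := by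
  refine Finite.of_injective (β := MulAction.orbitRel.Quotient H V)
    (Quotient.map' (proj hM) ?_) ?_
  · rintro _ y ⟨h, rfl⟩
    exact ⟨h, (proj_smul hM h y).symm⟩
  · intro x y
    induction x, y using Quotient.inductionOn₂' with
    | h x y =>
      intro hxy
      obtain ⟨h, hh⟩ : proj hM x ∈ MulAction.orbit H (proj hM y) := Quotient.exact' hxy
      refine Quotient.sound' ?_
      change x ∈ MulAction.orbit H y
      change h • proj hM y = proj hM x at hh
      rw [← proj_smul] at hh
      rcases eq_or_of_proj_eq hM hh with h1 | ⟨g, l, -, h1, h2⟩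
      · exact ⟨h, h1⟩
      · have h3 : x = (g * l * g⁻¹) • h • y := by
          rw [h1, h2, smul_inr, smul_inr, smul_inr]
          simp
        rw [h3, smul_smul]
        exact ⟨_, rfl⟩

theorem isOpen_stabilizer [TopologicalSpace H] [IsTopologicalGroup H] (hMo : IsOpen (M : Set H))
    (hopen : ∀ v : V, IsOpen (MulAction.stabilizer H v : Set H)) (x : SplitOrbit v M) :
    IsOpen (MulAction.stabilizer H x : Set H) := by
  obtain ⟨x, hx⟩ | x := x
  · convert hopen x using 1
    ext h
    simp only [SetLike.mem_coe, MulAction.mem_stabilizer_iff]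
    exact ⟨fun e => congrArg Subtype.val (Sum.inl_injective e),
      fun e => congrArg Sum.inl (Subtype.ext e)⟩
  · induction x using QuotientGroup.induction_on with
    | H g =>
      have : (MulAction.stabilizer H (Sum.inr (g : H ⧸ M) : SplitOrbit v M) : Set H) =
          (fun h => g⁻¹ * (h * g)) ⁻¹' M := by
        ext h
        rw [SetLike.mem_coe, MulAction.mem_stabilizer_iff, smul_inr, eq_comm]
        exact Sum.inr_injective.eq_iff.trans QuotientGroup.eq
      rw [this]
      exact hMo.preimage (by fun_prop)

/-- The map to the `H`-set for a larger subgroup. -/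
def mapOfLE {M' : Subgroup H} (h : M ≤ M') : SplitOrbit v M → SplitOrbit v M' :=
  Sum.map id (Subgroup.quotientMapOfLE h)

theorem mapOfLE_smul {M' : Subgroup H} (h : M ≤ M') (g : H) (x : SplitOrbit v M) :
    mapOfLE h (g • x) = g • mapOfLE h x := by
  obtain x | x := x
  · rfl
  · induction x using QuotientGroup.induction_on with
    | H g => rfl

theorem proj_mapOfLE {M' : Subgroup H} (h : M ≤ M') (hM' : M' ≤ MulAction.stabilizer H v)
    (x : SplitOrbit v M) : proj hM' (mapOfLE h x) = proj hM x := by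
  obtain x | x := x
  · rfl
  · induction x using QuotientGroup.induction_on with
    | H g => rfl

end SplitOrbit

variable [TopologicalSpace H] [IsTopologicalGroup H] [LocallyCompactSpace H] [T2Space H]
  {μ : CoxeterMatrix V} {hμ : ∀ (g : H) (s t : V), μ (g • s) (g • t) = μ s t}

/-- With `M ≤ L` open and compactly generated, splitting `H/L` into `H/M` gives a cover whose kernel
is normally generated by the `w_M w_{lM}`, `l ∈ L`. Finitely many `l` suffice. Adjoining them to `M`
gives `M'`, and the map to the group built on `H/M'` kills the whole kernel; so `w_{M'} = w_{lM'}`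
for every `l ∈ L`, and `l ∈ M'` because generators are distinct. -/
theorem IsCompactlyPresentedGroup.isCompactlyGeneratedGroup_stabilizer
    (hopen : ∀ v : V, IsOpen (MulAction.stabilizer H v : Set H))
    (hG : IsCompactlyPresentedGroup (WreathedCoxeterGroup μ hμ)) (v : V) :
    IsCompactlyGeneratedGroup (MulAction.stabilizer H v) := by
  have := wreathed_isTopologicalGroup (μ := μ) (hμ := hμ) hopen
  obtain ⟨hfin, hH⟩ := hG.isCompactlyGeneratedGroup.of_wreathed
  -- The compact neighbourhood makes `M` open, so the coset space `H/M` again has open stabilizers.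
  obtain ⟨K, hK1, hKL, hK⟩ := local_compact_nhds ((hopen v).mem_nhds (Subgroup.one_mem _))
  set L := MulAction.stabilizer H v with hL
  have hM : Subgroup.closure K ≤ L := (Subgroup.closure_le _).mpr hKL
  set M := Subgroup.closure K with hMdef
  have hMo : IsOpen (M : Set H) :=
    M.isOpen_of_mem_nhds (Filter.mem_of_superset hK1 Subgroup.subset_closure)
  let q := SplitOrbit.proj hM
  have hq := SplitOrbit.proj_smul hM
  have hX := μ.pullback_smul q hμ hq
  have hoX := SplitOrbit.isOpen_stabilizer (v := v) hMo hopen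
  have := wreathed_isTopologicalGroup (μ := μ.pullback q) (hμ := hX) hoX
  have := SplitOrbit.finite_orbits hM
  have hqs : Function.Surjective q := SplitOrbit.proj_surjective hM
  let π : WreathedCoxeterGroup (μ.pullback q) hX →* WreathedCoxeterGroup μ hμ :=
    wreathedMap q hq (μ.dvd_pullback q)
  have hπ : IsOpenQuotientMap π := wreathedMap_isOpenQuotientMap hoX hopen hqs
  have : DiscreteTopology π.ker := wreathedMap_discreteTopology_ker hoX
  let w := (μ.pullback q).simple
  let rel : L → WreathedCoxeterGroup (μ.pullback q) hX := fun l =>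
    inl (w (Sum.inr ((1 : H) : H ⧸ M)) * w (Sum.inr ((l : H) : H ⧸ M)))
  let N : L → Subgroup (WreathedCoxeterGroup (μ.pullback q) hX) := fun l =>
    Subgroup.normalClosure {rel l}
  have hrel : ∀ l, rel l ∈ ⨆ l, N l := fun l =>
    le_iSup N l (Subgroup.subset_normalClosure rfl)
  have hker : π.ker ≤ ⨆ l, N l := by
    refine wreathedMap_ker_le hqs _ fun x y => ?_
    -- Relations between different fibres already hold in the cover; only those within a fibre are
    -- new.
    rcases eq_or_ne (q x) (q y) with h | h
    · rw [h, μ.diagonal, pow_one]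
      rcases SplitOrbit.eq_or_of_proj_eq hM h with rfl | ⟨g, l, hl, rfl, rfl⟩
      · rw [CoxeterMatrix.simple_mul_self, map_one]
        exact Subgroup.one_mem _
      · rw [map_mul, inl_simple_smul, inl_simple_smul]
        have := (Subgroup.iSup_normal N).conj_mem _ (hrel ⟨l, hl⟩) (inr g)
        convert this using 1
        simp only [rel, map_mul, map_inv, w]
        group
    · rw [← map_pow, ← μ.pullback_of_ne q h, CoxeterMatrix.simple_mul_simple_pow, map_one]
      exact Subgroup.one_mem _
  obtain ⟨t, ht⟩ := hG.exists_finset_ker_le (wreathed_isCompactlyGeneratedGroup hH) hπ N hker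
  set K' := K ∪ Subtype.val '' (t : Set L) with hK'
  have hK'c : IsCompact K' := hK.union (t.finite_toSet.image _).isCompact
  have hM' : Subgroup.closure K' ≤ L := by
    refine (Subgroup.closure_le _).mpr (Set.union_subset hKL ?_)
    rintro _ ⟨l, -, rfl⟩
    exact l.2
  refine IsCompactlyGeneratedGroup.of_subgroup_closure hK'c (le_antisymm hM' fun l hl => ?_)
  set M' := Subgroup.closure K'
  have hMM' : M ≤ M' := Subgroup.closure_mono Set.subset_union_left
  let q' := SplitOrbit.proj hM'
  let r := SplitOrbit.mapOfLE (v := v) hMM'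
  let f : WreathedCoxeterGroup (μ.pullback q) hX →* WreathedCoxeterGroup (μ.pullback q')
      (μ.pullback_smul q' hμ (SplitOrbit.proj_smul hM')) :=
    wreathedMap r (SplitOrbit.mapOfLE_smul hMM')
      (μ.pullback_dvd_pullback q q' (SplitOrbit.proj_mapOfLE hM hMM' hM'))
  have hfrel : ∀ l : L, f (rel l) = inl ((μ.pullback q').simple (Sum.inr ((1 : H) : H ⧸ M')) *
      (μ.pullback q').simple (Sum.inr ((l : H) : H ⧸ M'))) := by
    intro l
    simp only [rel, map_mul]
    exact congrArg₂ _ (wreathedMap_inl_simple _) (wreathedMap_inl_simple _)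
  have hle : π.ker ≤ f.ker := by
    refine ht.trans (iSup₂_le fun l hl => Subgroup.normalClosure_le_normal ?_)
    rintro _ rfl
    have hl' : (((1 : H) : H ⧸ M')) = ((l : H) : H ⧸ M') := by
      rw [QuotientGroup.eq, inv_one, one_mul]
      exact Subgroup.subset_closure (Or.inr ⟨l, hl, rfl⟩)
    rw [SetLike.mem_coe, MonoidHom.mem_ker, hfrel, hl', CoxeterMatrix.simple_mul_self, map_one]
  have h1 : rel ⟨l, hl⟩ ∈ π.ker := by
    have hql : q (Sum.inr ((1 : H) : H ⧸ M)) = q (Sum.inr (l : H ⧸ M)) := by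
      change (1 : H) • v = l • v
      rw [one_smul, MulAction.mem_stabilizer_iff.mp hl]
    have := wreathedMap_relation_mem_ker (q := q) (hX := hX) (hY := hμ) (hq := hq)
      (hdvd := μ.dvd_pullback q) (Sum.inr ((1 : H) : H ⧸ M)) (Sum.inr (l : H ⧸ M))
    rwa [hql, μ.diagonal, pow_one] at this
  have h2 := hle h1
  rw [MonoidHom.mem_ker, hfrel, ← map_one inl] at h2
  have h3 := eq_inv_of_mul_eq_one_left (inl_injective h2)
  rw [CoxeterMatrix.simple_inv] at h3
  have h4 := QuotientGroup.eq.mp (Sum.inr_injective (CoxeterMatrix.simple_injective _ h3))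
  simpa using h4

end Stabilizers

/-! ### Independence of the Coxeter relations -/

section Truncation

variable {V : Type u} (H : Type v) [Group H] [MulAction H V]

/-- The pair of diagonal orbits of a pair of points and of the swapped pair. -/
def pairClass (s t : V) : Set (Set (V × V)) :=
  {MulAction.orbit H (s, t), MulAction.orbit H (t, s)}

theorem pairClass_comm (s t : V) : pairClass H s t = pairClass H t s := Set.pair_comm _ _

variable {H} in
theorem pairClass_smul (g : H) (s t : V) : pairClass H (g • s) (g • t) = pairClass H s t := by
  have h : ∀ s t : V, MulAction.orbit H (g • s, g • t) = MulAction.orbit H (s, t) := fun s t =>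
    MulAction.orbit_smul g (s, t)
  rw [pairClass, h, h, pairClass]

/-- The Coxeter matrix in which the entries outside the given classes of pairs are replaced by
`∞`. -/
noncomputable def CoxeterMatrix.truncate (μ : CoxeterMatrix V) (A : Set (Set (Set (V × V)))) :
    CoxeterMatrix V := by
  classical exact
  { M := fun s t => if s = t then 1 else if pairClass H s t ∈ A then μ s t else 0
    isSymm := by
      refine Matrix.IsSymm.ext fun s t => ?_
      simp only [eq_comm (a := t), pairClass_comm H t, μ.symmetric t]
    diagonal := by simp
    off_diagonal := fun s t hst => by
      rw [if_neg hst]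
      split_ifs
      · exact μ.off_diagonal s t hst
      · simp }

variable {H} (μ : CoxeterMatrix V)

theorem CoxeterMatrix.truncate_of_mem {A : Set (Set (Set (V × V)))} {s t : V}
    (h : pairClass H s t ∈ A) : μ.truncate H A s t = μ s t := by
  rcases eq_or_ne s t with rfl | hst
  · simp
  · simp [truncate, hst, h]

theorem CoxeterMatrix.truncate_of_notMem {A : Set (Set (Set (V × V)))} {s t : V} (hst : s ≠ t)
    (h : pairClass H s t ∉ A) : μ.truncate H A s t = 0 := by
  simp [truncate, hst, h]

theorem CoxeterMatrix.truncate_dvd_truncate {A B : Set (Set (Set (V × V)))} (hAB : A ⊆ B)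
    (s t : V) : μ.truncate H B s t ∣ μ.truncate H A s t := by
  rcases eq_or_ne s t with rfl | hst
  · simp
  by_cases h : pairClass H s t ∈ A
  · rw [μ.truncate_of_mem h, μ.truncate_of_mem (hAB h)]
  · rw [μ.truncate_of_notMem hst h]
    exact dvd_zero _

theorem CoxeterMatrix.dvd_truncate (A : Set (Set (Set (V × V)))) (s t : V) :
    μ s t ∣ μ.truncate H A s t := by
  have := μ.truncate_dvd_truncate (H := H) (Set.subset_univ A) s t
  rwa [μ.truncate_of_mem (Set.mem_univ _)] at this

variable {μ}

theorem CoxeterMatrix.truncate_smul (hμ : ∀ (g : H) (s t : V), μ (g • s) (g • t) = μ s t)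
    (A : Set (Set (Set (V × V)))) (g : H) (s t : V) :
    μ.truncate H A (g • s) (g • t) = μ.truncate H A s t := by
  rcases eq_or_ne s t with rfl | hst
  · simp
  have hst' : g • s ≠ g • t := fun e => hst (MulAction.injective g e)
  by_cases h : pairClass H s t ∈ A
  · rw [μ.truncate_of_mem h, μ.truncate_of_mem (by rwa [pairClass_smul]), hμ]
  · rw [μ.truncate_of_notMem hst h, μ.truncate_of_notMem hst' (by rwa [pairClass_smul])]

/-- Each class consists of at most two orbits, and the diagonal contributes only finitely many
orbits. -/
theorem infinite_image_pairClass [Finite (MulAction.orbitRel.Quotient H V)]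
    (hP : (MulAction.orbit H '' {p : V × V | μ p.1 p.2 ≠ 0}).Infinite) :
    ((fun p : V × V => pairClass H p.1 p.2) '' {p | p.1 ≠ p.2 ∧ μ p.1 p.2 ≠ 0}).Infinite := by
  intro hfin
  refine hP (((hfin.biUnion (t := id) ?_).union (Set.finite_range
    fun x : MulAction.orbitRel.Quotient H V => MulAction.orbit H (x.out, x.out))).subset ?_)
  · rintro _ ⟨p, -, rfl⟩
    exact Set.toFinite {MulAction.orbit H (p.1, p.2), MulAction.orbit H (p.2, p.1)}
  · rintro _ ⟨⟨s, t⟩, hp, rfl⟩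
    rcases eq_or_ne s t with rfl | hst
    · obtain ⟨h, hh⟩ := MulAction.exists_eq_smul_out (H := H) s
      refine Or.inr ⟨Quotient.mk _ s, ?_⟩
      conv_rhs => rw [hh]
      exact (MulAction.orbit_smul h (_, _)).symm
    · exact Or.inl (Set.mem_biUnion ⟨(s, t), ⟨hst, hp⟩, rfl⟩ (Or.inl rfl))

variable (μ) (hμ : ∀ (g : H) (s t : V), μ (g • s) (g • t) = μ s t)

/-- The wreathed group of the free product of groups of order two indexed by `V`. -/
abbrev FreeWreathedGroup : Type (max u v) :=
  WreathedCoxeterGroup (μ.truncate H ∅) (CoxeterMatrix.truncate_smul hμ ∅)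

/-- The projection of the free wreathed group to a wreathed Coxeter group. -/
noncomputable def freeWreathedProj : FreeWreathedGroup μ hμ →* WreathedCoxeterGroup μ hμ :=
  wreathedMap id (fun _ _ => rfl) (μ.dvd_truncate ∅)

/-- The normal subgroup of the free wreathed group generated by the Coxeter relations of a class of
pairs. -/
noncomputable def relationSubgroup (c : Set (Set (V × V))) : Subgroup (FreeWreathedGroup μ hμ) :=
  Subgroup.normalClosure {x | ∃ s t, pairClass H s t = c ∧
    (inl ((μ.truncate H ∅).simple s * (μ.truncate H ∅).simple t)) ^ μ s t = x}

instance (c : Set (Set (V × V))) : (relationSubgroup μ hμ c).Normal :=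
  Subgroup.normalClosure_normal

/-- Diagonal relations already hold in the free wreathed group, and entries `∞` give trivial powers.
The `ULift` only places the index type in the universe of the group. -/
theorem iSup_relationSubgroup :
    ⨆ c : ULift.{v} ((fun p : V × V => pairClass H p.1 p.2) ''
      {p | p.1 ≠ p.2 ∧ μ p.1 p.2 ≠ 0}), relationSubgroup μ hμ c.down =
      (freeWreathedProj μ hμ).ker := by
  refine le_antisymm (iSup_le fun c => Subgroup.normalClosure_le_normal ?_)
    (wreathedMap_ker_le Function.surjective_id _ fun s t => ?_)
  · rintro _ ⟨s, t, -, rfl⟩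
    exact wreathedMap_relation_mem_ker (q := id) s t
  · by_cases hst : s ≠ t ∧ μ s t ≠ 0
    · refine le_iSup (fun c : ULift.{v} ((fun p : V × V => pairClass H p.1 p.2) ''
        {p | p.1 ≠ p.2 ∧ μ p.1 p.2 ≠ 0}) => relationSubgroup μ hμ c.down)
        ⟨⟨_, (s, t), hst, rfl⟩⟩ (Subgroup.subset_normalClosure ⟨s, t, rfl, rfl⟩)
    · convert Subgroup.one_mem _ using 1
      rw [not_and_or, not_not, not_not] at hst
      rcases hst with rfl | h
      · rw [CoxeterMatrix.simple_mul_self, map_one, one_pow]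
      · exact (congrArg _ h).trans (pow_zero _)

/-- Replacing `μ` by `∞` on a single class gives a wreathed Coxeter group in which the relations of
all other classes hold, while `w_s w_t` has infinite order for `(s, t)` in that class. -/
theorem independentSubgroups_relationSubgroup :
    IndependentSubgroups fun c : ULift.{v} ((fun p : V × V => pairClass H p.1 p.2) ''
      {p | p.1 ≠ p.2 ∧ μ p.1 p.2 ≠ 0}) => relationSubgroup μ hμ c.down := by
  rintro ⟨⟨_, ⟨s, t⟩, ⟨hst, hne⟩, rfl⟩⟩ hle
  let A : Set (Set (Set (V × V))) := {pairClass H s t}ᶜ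
  let f : FreeWreathedGroup μ hμ →* WreathedCoxeterGroup (μ.truncate H A)
      (CoxeterMatrix.truncate_smul hμ A) :=
    wreathedMap id (fun _ _ => rfl) (μ.truncate_dvd_truncate (Set.empty_subset A))
  have hf : ∀ x y, f ((inl ((μ.truncate H ∅).simple x * (μ.truncate H ∅).simple y)) ^ μ x y) =
      inl (((μ.truncate H A).simple x * (μ.truncate H A).simple y) ^ μ x y) := by
    intro x y
    rw [map_pow, map_mul, map_mul, map_pow, map_mul]
    congr 2 <;> exact wreathedMap_inl_simple _
  have hker := hle.trans (iSup_le fun c : {c // c ≠ _} =>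
    (Subgroup.normalClosure_le_normal (N := f.ker) ?_))
  · have h1 := hker (Subgroup.subset_normalClosure ⟨s, t, rfl, rfl⟩)
    rw [MonoidHom.mem_ker, hf, ← map_one inl] at h1
    exact CoxeterMatrix.simple_mul_simple_pow_ne_one _ (μ.truncate_of_notMem hst (not_not.mpr rfl))
      hne (inl_injective h1)
  · rintro _ ⟨x, y, hxy, rfl⟩
    rw [SetLike.mem_coe, MonoidHom.mem_ker, hf]
    have hA : pairClass H x y ∈ A := by
      rw [hxy]
      exact fun h => c.2 (ULift.ext _ _ (Subtype.ext h))
    rw [← μ.truncate_of_mem hA, CoxeterMatrix.simple_mul_simple_pow, map_one]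

end Truncation

/-! ### INIP, and finiteness of the number of orbits of pairs -/

section Independent

/-- A quotient of a compactly generated locally compact group by a discrete normal subgroup
generated by an infinite independent family of normal subgroups is INIP. -/
theorem isINIP_of_independentSubgroups {G G₁ : Type w} [Group G] [TopologicalSpace G] [Group G₁]
    [TopologicalSpace G₁] [IsTopologicalGroup G₁] [LocallyCompactSpace G₁] [T2Space G₁]
    (hG : IsCompactlyGeneratedGroup G) (hG₁ : IsCompactlyGeneratedGroup G₁) {π : G₁ →* G}
    (hπ : IsOpenQuotientMap π) [DiscreteTopology π.ker] {ι : Type w} [Infinite ι]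
    (N : ι → Subgroup G₁) (hN : ∀ i, (N i).Normal) (hind : IndependentSubgroups N)
    (hker : ⨆ i, N i = π.ker) : IsINIP G := by
  obtain ⟨G₀, _, _, _, _, _, π₀, hcp, hπ₀, hdisc⟩ := hG₁.exists_compactlyPresented_cover
  refine ⟨hG, G₀, inferInstance, inferInstance, inferInstance, inferInstance, inferInstance,
    π.comp π₀, hcp, hπ.comp hπ₀, ?_, ι, fun i => (N i).comap π₀, inferInstance,
    fun i => (hN i).comap π₀, ?_, ?_⟩
  -- A kernel element close to `1` first has trivial image in `G₁`, hence lies in the kernel of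
  -- `π₀`, and is then trivial itself.
  · obtain ⟨U, hU, hU1⟩ := π₀.ker.exists_mem_nhds_one_of_discreteTopology
    obtain ⟨U', hU', hU1'⟩ := π.ker.exists_mem_nhds_one_of_discreteTopology
    have hpre : π₀ ⁻¹' U' ∈ 𝓝 (1 : G₀) :=
      hπ₀.continuous.continuousAt.preimage_mem_nhds (by rwa [map_one])
    exact Subgroup.discreteTopology_of_mem_nhds_one _ (Filter.inter_mem hU hpre)
      fun x hx hxker => hU1 x hx.1 (hU1' _ hx.2 hxker)
  · intro i hle
    refine hind i ?_
    have := Subgroup.map_mono (f := π₀) hle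
    rw [Subgroup.map_iSup] at this
    simpa only [Subgroup.map_comap_eq_self_of_surjective hπ₀.surjective] using this
  · have h1 : (⨆ i, (N i).comap π₀).map π₀ = π.ker := by
      rw [Subgroup.map_iSup, ← hker]
      simp only [Subgroup.map_comap_eq_self_of_surjective hπ₀.surjective]
    -- Any one preimage contains the kernel of `π₀`; an index exists since `ι` is infinite.
    have h2 : π₀.ker ≤ ⨆ i, (N i).comap π₀ :=
      (Subgroup.ker_le_comap π₀ (N (Classical.arbitrary ι))).trans
        (le_iSup (fun i => (N i).comap π₀) _)
    rw [← Subgroup.comap_map_eq_self h2, h1, MonoidHom.comap_ker]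

variable {V : Type u} {H : Type v} [Group H] [TopologicalSpace H] [IsTopologicalGroup H]
  [LocallyCompactSpace H] [T2Space H] [MulAction H V] {μ : CoxeterMatrix V}
  {hμ : ∀ (g : H) (s t : V), μ (g • s) (g • t) = μ s t}

theorem wreathed_isINIP (hopen : ∀ v : V, IsOpen (MulAction.stabilizer H v : Set H))
    (hG : IsCompactlyGeneratedGroup (WreathedCoxeterGroup μ hμ))
    (hP : (MulAction.orbit H '' {p : V × V | μ p.1 p.2 ≠ 0}).Infinite) :
    IsINIP (WreathedCoxeterGroup μ hμ) := by
  obtain ⟨_, hH⟩ := hG.of_wreathed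
  have := wreathed_isTopologicalGroup (hμ := CoxeterMatrix.truncate_smul hμ ∅) hopen
  have := (infinite_image_pairClass hP).to_subtype
  have : DiscreteTopology (freeWreathedProj μ hμ).ker := wreathedMap_discreteTopology_ker hopen
  have hπ : IsOpenQuotientMap (freeWreathedProj μ hμ) :=
    wreathedMap_isOpenQuotientMap hopen hopen Function.surjective_id
  exact isINIP_of_independentSubgroups hG (wreathed_isCompactlyGeneratedGroup hH) hπ _ (fun _ => inferInstance)
    (independentSubgroups_relationSubgroup μ hμ) (iSup_relationSubgroup μ hμ)

/-- Infinitely many orbits would give the kernel from the free wreathed group an infinite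
independent generating family, which a compactly presented quotient forbids. -/
theorem IsCompactlyPresentedGroup.finite_orbits_of_wreathed
    (hopen : ∀ v : V, IsOpen (MulAction.stabilizer H v : Set H))
    (hG : IsCompactlyPresentedGroup (WreathedCoxeterGroup μ hμ)) :
    (MulAction.orbit H '' {p : V × V | μ p.1 p.2 ≠ 0}).Finite := by
  by_contra hP
  obtain ⟨_, hH⟩ := hG.isCompactlyGeneratedGroup.of_wreathed
  have := wreathed_isTopologicalGroup (hμ := hμ) hopen
  have := wreathed_isTopologicalGroup (hμ := CoxeterMatrix.truncate_smul hμ ∅) hopen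
  have := (infinite_image_pairClass hP).to_subtype
  have : DiscreteTopology (freeWreathedProj μ hμ).ker := wreathedMap_discreteTopology_ker hopen
  have hπ : IsOpenQuotientMap (freeWreathedProj μ hμ) :=
    wreathedMap_isOpenQuotientMap hopen hopen Function.surjective_id
  exact not_isCompactlyPresentedGroup_of_independentSubgroups
    (wreathed_isCompactlyGeneratedGroup hH) hπ _
    (independentSubgroups_relationSubgroup μ hμ) (iSup_relationSubgroup μ hμ) hG

end Independent

/-! ### Transitive actions and double cosets -/

section Transitive

variable {V : Type u} {H : Type v} [Group H] [MulAction H V]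

theorem IsCompactlyGeneratedGroup.stabilizer_smul [TopologicalSpace H] [IsTopologicalGroup H]
    {v : V} (h : IsCompactlyGeneratedGroup (MulAction.stabilizer H v)) (g : H) :
    IsCompactlyGeneratedGroup (MulAction.stabilizer H (g • v)) := by
  obtain ⟨S, hS, hgen⟩ := h
  refine IsCompactlyGeneratedGroup.of_subgroup_closure
    (K := MulAut.conj g '' (Subtype.val '' S)) ?_ ?_
  · refine (hS.image continuous_subtype_val).image ?_
    change Continuous fun x => g * x * g⁻¹
    fun_prop
  · rw [MulAction.stabilizer_smul_eq_stabilizer_map_conj]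
    have h1 := MonoidHom.map_closure (MulAction.stabilizer H v).subtype S
    rw [hgen, ← MonoidHom.range_eq_map, Subgroup.range_subtype] at h1
    exact (MonoidHom.map_closure (MulAut.conj g).toMonoidHom _).symm.trans
      (congrArg (Subgroup.map _) h1.symm)

/-- By transitivity each orbit of pairs contains some `(v, h • v)`, and `h` is determined exactly up
to its double coset. -/
theorem finite_orbits_prod_iff_finite_doubleCoset {v : V} (hv : ∀ w : V, ∃ h : H, h • v = w)
    {L : Subgroup H} (hL : MulAction.stabilizer H v = L) :
    (MulAction.orbit H '' (Set.univ : Set (V × V))).Finite ↔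
      Finite (DoubleCoset.Quotient (L : Set H) (L : Set H)) := by
  have hmem : ∀ g : H, g ∈ L ↔ g • v = v := fun g => by rw [← hL, MulAction.mem_stabilizer_iff]
  let f : H → Set (V × V) := fun h => MulAction.orbit H (v, h • v)
  have hf : ∀ a b : H, f a = f b ↔ DoubleCoset.mk L L a = DoubleCoset.mk L L b := by
    intro a b
    rw [DoubleCoset.eq, eq_comm (a := f a)]
    refine MulAction.orbit_eq_iff.trans ⟨?_, ?_⟩
    · rintro ⟨g, hg⟩
      obtain ⟨h1, h2⟩ := Prod.ext_iff.mp hg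
      change g • v = v at h1
      change g • a • v = b • v at h2
      refine ⟨g, (hmem g).mpr h1, a⁻¹ * g⁻¹ * b, (hmem _).mpr ?_, by group⟩
      rw [mul_smul, mul_smul, ← h2, inv_smul_smul, inv_smul_smul]
    · rintro ⟨g, hg, k, hk, rfl⟩
      refine ⟨g, Prod.ext ((hmem g).mp hg) ?_⟩
      change g • a • v = (g * a * k) • v
      rw [mul_smul, mul_smul, (hmem k).mp hk]
  let F : DoubleCoset.Quotient (L : Set H) (L : Set H) → Set (V × V) :=
    Quotient.lift f fun a b hab => (hf a b).mpr (Quotient.sound hab)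
  have hF : Function.Injective F := by
    intro x y
    induction x, y using Quotient.inductionOn₂ with
    | h a b => exact fun hab => (hf a b).mp hab
  have hrange : MulAction.orbit H '' (Set.univ : Set (V × V)) = Set.range F := by
    ext O
    constructor
    · rintro ⟨⟨s, t⟩, -, rfl⟩
      obtain ⟨g, rfl⟩ := hv s
      obtain ⟨k, rfl⟩ := hv t
      refine ⟨DoubleCoset.mk L L (g⁻¹ * k), ?_⟩
      change MulAction.orbit H (v, (g⁻¹ * k) • v) = _
      rw [← MulAction.orbit_smul g, Prod.smul_mk, smul_smul, mul_inv_cancel_left]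
    · rintro ⟨x, rfl⟩
      induction x using Quotient.inductionOn with
      | h a => exact ⟨(v, a • v), trivial, rfl⟩
  rw [hrange, Set.Finite, ← (Equiv.ofInjective F hF).finite_iff]

end Transitive

/-! ### The main theorem -/

theorem wreathed_isCompactlyPresentedGroup_iff {V : Type u} {H : Type v}
    [Group H] [TopologicalSpace H] [IsTopologicalGroup H] [LocallyCompactSpace H] [T2Space H]
    [MulAction H V] (hopen : ∀ v : V, IsOpen (MulAction.stabilizer H v : Set H))
    (μ : CoxeterMatrix V) (hμ : ∀ (g : H) (s t : V), μ (g • s) (g • t) = μ s t) :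
    IsCompactlyPresentedGroup (WreathedCoxeterGroup μ hμ) ↔
      (Finite (MulAction.orbitRel.Quotient H V) ∧
        ∀ v : V, IsCompactlyGeneratedGroup (MulAction.stabilizer H v)) ∧
      IsCompactlyPresentedGroup H ∧
      (MulAction.orbit H '' {p : V × V | μ p.1 p.2 ≠ 0}).Finite := by
  constructor
  · intro hG
    have := wreathed_isTopologicalGroup (hμ := hμ) hopen
    exact ⟨⟨hG.isCompactlyGeneratedGroup.of_wreathed.1,
      hG.isCompactlyGeneratedGroup_stabilizer hopen⟩,
      hG.of_retract inr rightHom continuous_wreathed_inr continuous_rightHom fun x => rightHom_inr x,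
      hG.finite_orbits_of_wreathed hopen⟩
  · rintro ⟨⟨_, hstab⟩, hH, hP⟩
    exact wreathed_isCompactlyPresentedGroup hstab hH hP

theorem mainTheorem6 {V : Type u} {H : Type v} [Nonempty V]
    [Group H] [TopologicalSpace H] [IsTopologicalGroup H] [LocallyCompactSpace H] [T2Space H]
    [MulAction H V] (hopen : ∀ v : V, IsOpen (MulAction.stabilizer H v : Set H))
    (μ : CoxeterMatrix V) (hμ : ∀ (g : H) (s t : V), μ (g • s) (g • t) = μ s t) :
    (IsCompactlyPresentedGroup (WreathedCoxeterGroup μ hμ) ↔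
      (Finite (MulAction.orbitRel.Quotient H V) ∧
        ∀ v : V, IsCompactlyGeneratedGroup (MulAction.stabilizer H v)) ∧
      IsCompactlyPresentedGroup H ∧
      (MulAction.orbit H '' {p : V × V | μ p.1 p.2 ≠ 0}).Finite) ∧
    (∀ (L : Subgroup H) (e : V ≃ H ⧸ L), (∀ (h : H) (v : V), e (h • v) = h • e v) →
      (∀ s t : V, μ s t ≠ 0) →
      ((MulAction.orbit H '' {p : V × V | μ p.1 p.2 ≠ 0}).Finite ↔
        Finite (DoubleCoset.Quotient (L : Set H) (L : Set H))) ∧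
      (IsCompactlyPresentedGroup (WreathedCoxeterGroup μ hμ) ↔
        IsCompactlyPresentedGroup H ∧ IsCompactlyGeneratedGroup L ∧
          Finite (DoubleCoset.Quotient (L : Set H) (L : Set H)))) ∧
    (IsCompactlyGeneratedGroup (WreathedCoxeterGroup μ hμ) →
      (MulAction.orbit H '' {p : V × V | μ p.1 p.2 ≠ 0}).Infinite →
      IsINIP (WreathedCoxeterGroup μ hμ)) := by
  have hiff := wreathed_isCompactlyPresentedGroup_iff hopen μ hμ
  refine ⟨hiff, fun L e he hne => ?_, wreathed_isINIP hopen⟩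
  set o : V := e.symm ((1 : H) : H ⧸ L) with ho
  have hto : ∀ w : V, ∃ h : H, h • o = w := by
    intro w
    obtain ⟨h, hh⟩ := QuotientGroup.mk_surjective (e w)
    refine ⟨h, e.injective ?_⟩
    rw [he, ho, e.apply_symm_apply, ← hh, MulAction.Quotient.smul_coe, smul_eq_mul, mul_one]
  have hL : MulAction.stabilizer H o = L := by
    ext g
    rw [MulAction.mem_stabilizer_iff, ← e.apply_eq_iff_eq, he, ho, e.apply_symm_apply,
      MulAction.Quotient.smul_coe, smul_eq_mul, mul_one, eq_comm, QuotientGroup.eq, inv_one,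
      one_mul]
  have hP : {p : V × V | μ p.1 p.2 ≠ 0} = Set.univ := Set.eq_univ_of_forall fun p => hne p.1 p.2
  have hfin : (MulAction.orbit H '' {p : V × V | μ p.1 p.2 ≠ 0}).Finite ↔
      Finite (DoubleCoset.Quotient (L : Set H) (L : Set H)) := by
    rw [hP]
    exact finite_orbits_prod_iff_finite_doubleCoset hto hL
  refine ⟨hfin, ?_⟩
  rw [hiff, hfin]
  constructor
  · rintro ⟨⟨-, hstab⟩, hH, hD⟩
    exact ⟨hH, hL ▸ hstab o, hD⟩
  · rintro ⟨hH, hLcg, hD⟩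
    refine ⟨⟨?_, fun w => ?_⟩, hH, hD⟩
    · have : Subsingleton (MulAction.orbitRel.Quotient H V) := by
        refine ⟨fun x y => ?_⟩
        induction x, y using Quotient.inductionOn₂' with
        | h x y =>
          obtain ⟨g, rfl⟩ := hto x
          obtain ⟨k, rfl⟩ := hto y
          exact Quotient.sound' ⟨g * k⁻¹, by simp [smul_smul]⟩
      infer_instance
    · obtain ⟨g, rfl⟩ := hto w
      rw [← hL] at hLcg
      exact hLcg.stabilizer_smul g
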